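/- Notation. Functions on $(0,\infty)$ are extended by $0$ to $\mathbb{R}$. $B(0,\infty)^+$ is the set of nonnegative bounded Borel functions on $(0,\infty)$, and $C^1(0,\infty)^+$ is the set of nonnegative bounded continuously differentiable functions on $(0,\infty)$ with bounded derivative. $\mathfrak{N}(0,\infty)$ is the space of finite integer-valued Borel measures on $(0,\infty)$ with the topology of weak convergence and its Borel $\sigma$-algebra, $\mathfrak{N}(0,\infty)^\circ=\mathfrak{N}(0,\infty)\setminus\{0\}$, and $\langle\nu,f\rangle=\int_{(0,\infty)} f\,d\nu$. Parameters. Let $\alpha\in C^1(0,\infty)^+$. For each $x>0$ let $(p(x,i))_{i\ge 0}$ be a probability distribution on $\{0,1,2,\dots\}$ with $p(\cdot,i)\in C^1(0,\infty)^+$ for every $i$, and put $g(x,z)=\sum_{i\ge 0} p(x,i)z^i$ for $z\in[0,1]$ and $g'(x,1-)=\sum_{i\ge 1} i\,p(x,i)$; assume $\sup_{x>0} g'(x,1-)<\infty$. Let $G$ be a probability measure on $(0,\infty)$ without atoms; write $G(t)=G((0,t])$. Let $L$ be a finite measure on $\mathfrak{N}(0,\infty)^\circ$ and $\psi(f)=\int(1-e^{-\langle\nu,f\rangle})\,L(d\nu)$.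 For $f\in B(0,\infty)^+$ let $(t,x)\mapsto u_tf(x)$, $t\ge0$, $x>0$, be the unique nonnegative Borel solution of $$u_tf(x)=f(x-t)+\int_0^t\alpha(x-s)\big[1-g\big(x-s,\langle G,e^{-u_{t-s}f}\rangle\big)\big]\,ds .$$ The $(\alpha,g,G,\psi)$-process (the remaining-lifetime age-structured branching process with immigration) is the Markov process in $\mathfrak{N}(0,\infty)$ whose transition semigroup $(P_t)_{t\ge0}$ is given by $$\int_{\mathfrak{N}(0,\infty)} e^{-\langle\nu,f\rangle}P_t(\sigma,d\nu)=\exp\Big\{-\langle\sigma,u_tf\rangle-\int_0^t\psi(u_sf)\,ds\Big\},\qquad f\in B(0,\infty)^+ .$$ Theorem. Assume that (i) $\displaystyle\int_0^\infty ds\int_{(s,\infty)}\alpha(x-s)g'(x-s,1-)\,G(dx)<1$; (ii) $\alpha_1\in(0,\infty)$ is such that $t\mapsto e^{\alpha_1t}[1-G(t)]$ is directly Riemann integrable over $[0,\infty)$ and $\displaystyle\int_0^\infty e^{\alpha_1s}\,ds\int_{(s,\infty)}\alpha(x-s)g'(x-s,1-)\,G(dx)=1$; (iii) $\displaystyle\int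 L(d\nu)\int_{(0,\infty)}e^{\alpha_1x}\,\nu(dx)<\infty$. Here a function $h\ge0$ on $[0,\infty)$ is directly Riemann integrable if, with $M_n(a)$ and $m_n(a)$ the supremum and infimum of $h$ over $[(n-1)a,na]$, one has $\sum_{n\ge1}aM_n(a)<\infty$ for every $a>0$ and the limits $\lim_{a\to0+}\sum_{n\ge 1} aM_n(a)$ and $\lim_{a\to0+}\sum_{n\ge 1} am_n(a)$ exist and are equal. Then there is a probability measure $\eta$ on $\mathfrak{N}(0,\infty)$ such that, for every $\sigma\in\mathfrak{N}(0,\infty)$, $P_t(\sigma,\cdot)$ converges weakly to $\eta$ as $t\to\infty$. Moreover, for every $f\in B(0,\infty)^+$ one has $\int_0^\infty\psi(u_sf)\,ds<\infty$ and $$\int_{\mathfrak{N}(0,\infty)}e^{-\langle\nu,f\rangle}\,\eta(d\nu)=\exp\Big\{-\int_0^\infty\psi(u_sf)\,ds\Big\}.$$ -/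

import Mathlib

open MeasureTheory ProbabilityTheory Filter Topology
open scoped NNReal ENNReal

noncomputable section

namespace AgeBranching

/-- The half-line `(0, ∞)` of remaining lifetimes, with its usual topology and Borel sets. -/
abbrev Life : Type := Set.Ioi (0 : ℝ)

/-- A function on `(0, ∞)`, extended by `0` to the whole real line. -/
def zext (h : Life → ℝ) (x : ℝ) : ℝ := if hx : x ∈ Set.Ioi (0 : ℝ) then h ⟨x, hx⟩ else 0

/-- `h` is nonnegative, bounded and continuously differentiable on `(0, ∞)`, with bounded
derivative. -/
structure IsC1BddPos (h : Life → ℝ) : Prop where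
  nonneg : ∀ x, 0 ≤ h x
  bdd : ∃ K : ℝ, ∀ x, h x ≤ K
  contDiffOn : ContDiffOn ℝ 1 (zext h) (Set.Ioi 0)
  deriv_bdd : ∃ K : ℝ, ∀ x : Life, |deriv (zext h) x| ≤ K

/-- `B(0, ∞)⁺`: the nonnegative bounded Borel functions on `(0, ∞)`. -/
structure BPos where
  toFun : Life → ℝ
  measurable : Measurable toFun
  nonneg : ∀ x, 0 ≤ toFun x
  bdd : ∃ K : ℝ, ∀ x, toFun x ≤ K

/-- `𝔑(0, ∞)`: the finite integer-valued Borel measures on `(0, ∞)`. -/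
def IntMeasure : Type :=
  {ν : FiniteMeasure Life // ∀ B : Set Life, MeasurableSet B → ∃ n : ℕ, ν B = n}

namespace IntMeasure

/-- The topology of weak convergence. -/
instance : TopologicalSpace IntMeasure := instTopologicalSpaceSubtype

instance : MeasurableSpace IntMeasure := borel IntMeasure

instance : BorelSpace IntMeasure := ⟨rfl⟩

/-- The underlying measure. -/
def toMeasure (ν : IntMeasure) : Measure Life := (ν.1 : Measure Life)

/-- `⟨ν, f⟩`. -/
def pair (ν : IntMeasure) (f : Life → ℝ) : ℝ := ∫ x, f x ∂ν.toMeasure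

end IntMeasure

/-- `𝔑(0, ∞)° = 𝔑(0, ∞) ∖ {0}`. -/
abbrev NonzeroIntMeasure : Type := {ν : IntMeasure // ν.toMeasure ≠ 0}

/-- The parameters `(α, g, G)` of the branching mechanism: the birth rate `α`, the offspring laws
`p(x, ·)` (with generating functions `g(x, ·)`) and the lifetime law `G`, which has a continuous
distribution function. -/
structure BranchingParams where
  α : Life → ℝ
  α_c1 : IsC1BddPos α
  p : Life → PMF ℕ
  p_c1 : ∀ i, IsC1BddPos fun x => (p x i).toReal
  sup_mean_lt_top : ⨆ x, ∑' i : ℕ, p x i * (i : ℝ≥0∞) < ⊤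
  G : Measure Life
  isProbabilityMeasure_G : IsProbabilityMeasure G
  nullSingletonClass_G : NullSingletonClass G

attribute [instance] BranchingParams.isProbabilityMeasure_G BranchingParams.nullSingletonClass_G

namespace BranchingParams

variable (D : BranchingParams)

/-- The generating function `g(x, z) = ∑ i, p(x, i) z ^ i`, for `z ∈ [0, 1]`. -/
def g (x : Life) (z : ℝ) : ℝ := ∑' i : ℕ, (D.p x i).toReal * z ^ i

/-- The mean offspring number `g'(x, 1-) = ∑ i, p(x, i) i`. -/
def mean (x : Life) : ℝ := (∑' i : ℕ, D.p x i * (i : ℝ≥0∞)).toReal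

/-- `u` is a nonnegative Borel solution `(t, x) ↦ u t x` of
`u_t(x) = f(x - t) + ∫_0^t α(x - s) [1 - g(x - s, ⟨G, exp(-u_{t-s})⟩)] ds`,
where functions on `(0, ∞)` are extended by `0`. -/
structure IsCumulant (f : BPos) (u : ℝ≥0 → Life → ℝ) : Prop where
  measurable : Measurable (Function.uncurry u)
  nonneg : ∀ t x, 0 ≤ u t x
  eqn : ∀ (t : ℝ≥0) (x : Life), u t x = zext f.toFun (x - t) +
    ∫ s in (0 : ℝ)..t, zext D.α (x - s) *
      (1 - zext (fun y => D.g y (∫ z, Real.exp (-u (t - s).toNNReal z) ∂D.G)) (x - s))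

/-! ### The cumulant equation is well posed -/

lemma measurable_zext {h : Life → ℝ} (hh : Measurable h) : Measurable (zext h) := by
  unfold zext
  exact Measurable.dite (s := Set.Ioi (0 : ℝ)) hh
    (g := fun _ => (0 : ℝ)) measurable_const measurableSet_Ioi

lemma IsC1BddPos_measurable {h : Life → ℝ} (hh : IsC1BddPos h) : Measurable h := by
  have h1 : Continuous ((Set.Ioi (0 : ℝ)).domRestrict (zext h)) :=
    continuousOn_iff_continuous_domRestrict.1 hh.contDiffOn.continuousOn
  have h2 : (Set.Ioi (0 : ℝ)).domRestrict (zext h) = h := by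
    ext x
    simp [zext, Set.domRestrict]
  rw [← h2]
  exact h1.measurable

lemma p_hasSum (x : Life) : HasSum (fun i => (D.p x i).toReal) 1 := by
  have h := (D.p x).tsum_coe
  have h2 : Summable fun i => (D.p x i).toReal :=
    ENNReal.summable_toReal (by rw [h]; exact ENNReal.one_ne_top)
  have h3 : ∑' i, (D.p x i).toReal = 1 := by
    rw [← ENNReal.tsum_toReal_eq (fun i => (D.p x).apply_ne_top i), h]; simp
  exact h3 ▸ h2.hasSum

lemma g_summable (x : Life) {z : ℝ} (hz : z ∈ Set.Icc (0 : ℝ) 1) :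
    Summable fun i : ℕ => (D.p x i).toReal * z ^ i :=
  (D.p_hasSum x).summable.of_nonneg_of_le
    (fun i => mul_nonneg ENNReal.toReal_nonneg (pow_nonneg hz.1 i))
    (fun _ => mul_le_of_le_one_right ENNReal.toReal_nonneg (pow_le_one₀ hz.1 hz.2))

lemma exists_mean_bound : ∃ m : ℝ, 0 ≤ m ∧ ∀ x, Summable (fun i : ℕ => (D.p x i).toReal * i) ∧
    ∑' i : ℕ, (D.p x i).toReal * i ≤ m := by
  refine ⟨(⨆ x, ∑' i : ℕ, D.p x i * (i : ℝ≥0∞)).toReal, ENNReal.toReal_nonneg, fun x => ?_⟩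
  have h1 : ∑' i : ℕ, D.p x i * (i : ℝ≥0∞) ≤ ⨆ x, ∑' i : ℕ, D.p x i * (i : ℝ≥0∞) :=
    le_iSup (fun x => ∑' i : ℕ, D.p x i * (i : ℝ≥0∞)) x
  have h2 := (h1.trans_lt D.sup_mean_lt_top).ne
  have h3 : (fun i : ℕ => (D.p x i).toReal * i) = fun i : ℕ => (D.p x i * (i : ℝ≥0∞)).toReal := by
    ext i; simp
  rw [h3]
  refine ⟨ENNReal.summable_toReal h2, ?_⟩
  rw [← ENNReal.tsum_toReal_eq
    (fun i => ENNReal.mul_ne_top ((D.p x).apply_ne_top i) (ENNReal.natCast_ne_top i))]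
  exact ENNReal.toReal_mono D.sup_mean_lt_top.ne h1

lemma pow_sub_pow_le {a b : ℝ} (ha : a ∈ Set.Icc (0 : ℝ) 1) (hb : b ∈ Set.Icc (0 : ℝ) 1)
    (hab : a ≤ b) (i : ℕ) : b ^ i - a ^ i ≤ i * (b - a) := by
  induction i with
  | zero => simp
  | succ n ih =>
    have h1 : b ^ n ≤ 1 := pow_le_one₀ hb.1 hb.2
    have h2 : 0 ≤ b ^ n := pow_nonneg hb.1 n
    have h4 : a ^ n ≤ b ^ n := pow_le_pow_left₀ ha.1 hab n
    have : b ^ (n + 1) - a ^ (n + 1) = b ^ n * (b - a) + a * (b ^ n - a ^ n) := by ring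
    rw [this]
    push_cast
    nlinarith [mul_le_mul_of_nonneg_right h1 (sub_nonneg.2 hab),
      mul_le_mul_of_nonneg_right ha.2 (sub_nonneg.2 h4)]

lemma g_mono (x : Life) {a b : ℝ} (ha : a ∈ Set.Icc (0 : ℝ) 1) (hb : b ∈ Set.Icc (0 : ℝ) 1)
    (hab : a ≤ b) : D.g x a ≤ D.g x b :=
  (D.g_summable x ha).tsum_le_tsum
    (fun i => mul_le_mul_of_nonneg_left (pow_le_pow_left₀ ha.1 hab i) ENNReal.toReal_nonneg)
    (D.g_summable x hb)

lemma g_lip {m : ℝ} (hm : ∀ x, Summable (fun i : ℕ => (D.p x i).toReal * i) ∧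
      ∑' i : ℕ, (D.p x i).toReal * i ≤ m) (x : Life) {a b : ℝ} (ha : a ∈ Set.Icc (0 : ℝ) 1)
    (hb : b ∈ Set.Icc (0 : ℝ) 1) (hab : a ≤ b) : D.g x b - D.g x a ≤ m * (b - a) := by
  unfold g
  rw [← (D.g_summable x hb).tsum_sub (D.g_summable x ha)]
  calc ∑' i : ℕ, ((D.p x i).toReal * b ^ i - (D.p x i).toReal * a ^ i)
      ≤ ∑' i : ℕ, (D.p x i).toReal * i * (b - a) := by
        refine Summable.tsum_le_tsum (fun i => ?_)
          ((D.g_summable x hb).sub (D.g_summable x ha)) ((hm x).1.mul_right _)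
        rw [← mul_sub, mul_assoc]
        exact mul_le_mul_of_nonneg_left (pow_sub_pow_le ha hb hab i) ENNReal.toReal_nonneg
    _ = (∑' i : ℕ, (D.p x i).toReal * i) * (b - a) := tsum_mul_right
    _ ≤ m * (b - a) := mul_le_mul_of_nonneg_right (hm x).2 (sub_nonneg.2 hab)

lemma g_nonneg (x : Life) {a : ℝ} (ha : a ∈ Set.Icc (0 : ℝ) 1) : 0 ≤ D.g x a :=
  tsum_nonneg fun i => mul_nonneg ENNReal.toReal_nonneg (pow_nonneg ha.1 i)

lemma g_le_one (x : Life) {a : ℝ} (ha : a ∈ Set.Icc (0 : ℝ) 1) : D.g x a ≤ 1 := by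
  refine (D.g_mono x ha ⟨zero_le_one, le_rfl⟩ ha.2).trans ?_
  simp [g, (D.p_hasSum x).tsum_eq]

/-- The integrand of the cumulant equation. -/
def rate (y z : ℝ) : ℝ := zext D.α y * (1 - zext (fun w => D.g w z) y)

lemma rate_of_pos {y : ℝ} (hy : y ∈ Set.Ioi (0 : ℝ)) (z : ℝ) :
    D.rate y z = D.α ⟨y, hy⟩ * (1 - D.g ⟨y, hy⟩ z) := by
  have hy' : 0 < y := hy
  simp [rate, zext, hy']

lemma rate_of_not_pos {y : ℝ} (hy : ¬ y ∈ Set.Ioi (0 : ℝ)) (z : ℝ) : D.rate y z = 0 := by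
  have hy' : ¬ 0 < y := hy
  simp [rate, zext, hy']

lemma rate_nonneg (y : ℝ) {z : ℝ} (hz : z ∈ Set.Icc (0 : ℝ) 1) : 0 ≤ D.rate y z := by
  by_cases hy : y ∈ Set.Ioi (0 : ℝ)
  · rw [D.rate_of_pos hy]
    exact mul_nonneg (D.α_c1.nonneg _) (sub_nonneg.2 (D.g_le_one _ hz))
  · rw [D.rate_of_not_pos hy]

lemma exists_rate_bound : ∃ A : ℝ, 0 ≤ A ∧ ∀ y z, z ∈ Set.Icc (0 : ℝ) 1 → D.rate y z ≤ A := by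
  obtain ⟨A, hA⟩ := D.α_c1.bdd
  refine ⟨max A 0, le_max_right _ _, fun y z hz => ?_⟩
  by_cases hy : y ∈ Set.Ioi (0 : ℝ)
  · rw [D.rate_of_pos hy]
    refine (mul_le_of_le_one_right (D.α_c1.nonneg _) ?_).trans ((hA _).trans (le_max_left _ _))
    linarith [D.g_nonneg ⟨y, hy⟩ hz]
  · rw [D.rate_of_not_pos hy]; exact le_max_right _ _

lemma rate_anti (y : ℝ) {a b : ℝ} (ha : a ∈ Set.Icc (0 : ℝ) 1) (hb : b ∈ Set.Icc (0 : ℝ) 1)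
    (hab : a ≤ b) : D.rate y b ≤ D.rate y a := by
  by_cases hy : y ∈ Set.Ioi (0 : ℝ)
  · rw [D.rate_of_pos hy, D.rate_of_pos hy]
    exact mul_le_mul_of_nonneg_left (sub_le_sub_left (D.g_mono _ ha hb hab) _) (D.α_c1.nonneg _)
  · rw [D.rate_of_not_pos hy, D.rate_of_not_pos hy]

lemma exists_rate_lip : ∃ C : ℝ, 0 ≤ C ∧ ∀ y a b, a ∈ Set.Icc (0 : ℝ) 1 → b ∈ Set.Icc (0 : ℝ) 1 →
    |D.rate y a - D.rate y b| ≤ C * |a - b| := by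
  obtain ⟨A, hA⟩ := D.α_c1.bdd
  obtain ⟨m, hm0, hm⟩ := D.exists_mean_bound
  have hC : 0 ≤ max A 0 * m := mul_nonneg (le_max_right _ _) hm0
  have key : ∀ y a b, a ∈ Set.Icc (0 : ℝ) 1 → b ∈ Set.Icc (0 : ℝ) 1 → a ≤ b →
      |D.rate y a - D.rate y b| ≤ max A 0 * m * |a - b| := by
    intro y a b ha hb hab
    rw [abs_of_nonneg (sub_nonneg.2 (D.rate_anti y ha hb hab)), abs_sub_comm,
      abs_of_nonneg (sub_nonneg.2 hab)]
    by_cases hy : y ∈ Set.Ioi (0 : ℝ)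
    · rw [D.rate_of_pos hy, D.rate_of_pos hy, ← mul_sub, mul_assoc]
      refine mul_le_mul ((hA _).trans (le_max_left _ _)) ?_ ?_ (le_max_right _ _)
      · linarith [D.g_lip hm ⟨y, hy⟩ ha hb hab]
      · linarith [D.g_mono ⟨y, hy⟩ ha hb hab]
    · rw [D.rate_of_not_pos hy, D.rate_of_not_pos hy, sub_zero]
      exact mul_nonneg hC (sub_nonneg.2 hab)
  refine ⟨max A 0 * m, hC, fun y a b ha hb => ?_⟩
  rcases le_total a b with h | h
  · exact key y a b ha hb h
  · rw [abs_sub_comm, abs_sub_comm a b]; exact key y b a hb ha h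

lemma measurable_rate {Ω : Type*} [MeasurableSpace Ω] {y z : Ω → ℝ} (hy : Measurable y)
    (hz : Measurable z) (hz' : ∀ ω, z ω ∈ Set.Icc (0 : ℝ) 1) :
    Measurable fun ω => D.rate (y ω) (z ω) := by
  have h1 : Measurable fun ω => zext D.α (y ω) :=
    (measurable_zext (IsC1BddPos_measurable D.α_c1)).comp hy
  have h2 : Measurable fun ω => zext (fun w => D.g w (z ω)) (y ω) := by
    refine measurable_of_tendsto_metrizable
      (f := fun n ω => ∑ i ∈ Finset.range n, zext (fun w => (D.p w i).toReal) (y ω) * z ω ^ i)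
      (fun n => ?_) (tendsto_pi_nhds.2 fun ω => ?_)
    · exact Finset.measurable_sum _ fun i _ =>
        ((measurable_zext (IsC1BddPos_measurable (D.p_c1 i))).comp hy).mul (hz.pow_const i)
    · by_cases h : y ω ∈ Set.Ioi (0 : ℝ)
      · have h' : 0 < y ω := h
        simpa [zext, h', g] using (D.g_summable ⟨y ω, h⟩ (hz' ω)).hasSum.tendsto_sum_nat
      · have h' : ¬ 0 < y ω := h
        simp [zext, h']
  exact h1.mul (measurable_const.sub h2)

/-- `⟨G, exp(-u_t)⟩`. -/
def expG (u : ℝ≥0 → Life → ℝ) (t : ℝ≥0) : ℝ := ∫ z, Real.exp (-u t z) ∂D.G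

section
variable {u v : ℝ≥0 → Life → ℝ}

lemma integrable_exp (hu : Measurable (Function.uncurry u)) (hu0 : ∀ t x, 0 ≤ u t x) (t : ℝ≥0) :
    Integrable (fun z => Real.exp (-u t z)) D.G := by
  have hm : Measurable (u t) := hu.comp measurable_prodMk_left
  refine Integrable.of_bound (C := 1) (Real.measurable_exp.comp hm.neg).aestronglyMeasurable
    (Eventually.of_forall fun z => ?_)
  rw [Real.norm_eq_abs, Real.abs_exp]
  exact Real.exp_le_one_iff.2 (neg_nonpos.2 (hu0 t z))

lemma expG_mem (hu : Measurable (Function.uncurry u)) (hu0 : ∀ t x, 0 ≤ u t x) (t : ℝ≥0) :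
    D.expG u t ∈ Set.Icc (0 : ℝ) 1 := by
  refine ⟨integral_nonneg fun z => (Real.exp_pos _).le, ?_⟩
  calc D.expG u t ≤ ∫ _, (1 : ℝ) ∂D.G :=
        integral_mono (D.integrable_exp hu hu0 t) (integrable_const _)
          (fun z => Real.exp_le_one_iff.2 (neg_nonpos.2 (hu0 t z)))
    _ = 1 := by simp

lemma measurable_expG (hu : Measurable (Function.uncurry u)) : Measurable (D.expG u) := by
  have h : StronglyMeasurable (Function.uncurry fun t z => Real.exp (-u t z)) :=
    (Real.measurable_exp.comp hu.neg).stronglyMeasurable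
  exact h.integral_prod_right.measurable

end

/-- The right-hand side of the cumulant equation. -/
def rhs (f : BPos) (q : ℝ≥0 → ℝ) (t : ℝ≥0) (x : Life) : ℝ :=
  zext f.toFun (x - t) + ∫ s in (0 : ℝ)..t, D.rate (x - s) (q (t - s).toNNReal)

section
variable {q q' : ℝ≥0 → ℝ}

lemma intervalIntegrable_rate (hq : Measurable q) (hq' : ∀ t, q t ∈ Set.Icc (0 : ℝ) 1)
    (t : ℝ≥0) (x : Life) :
    IntervalIntegrable (fun s => D.rate (x - s) (q (t - s).toNNReal)) volume 0 t := by
  obtain ⟨A, hA0, hA⟩ := D.exists_rate_bound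
  have hm : Measurable fun s : ℝ => D.rate (x - s) (q (t - s).toNNReal) :=
    D.measurable_rate (by fun_prop)
      (hq.comp (measurable_real_toNNReal.comp (by fun_prop))) (fun s => hq' _)
  refine (intervalIntegrable_const (c := A)).mono_fun hm.aestronglyMeasurable
    (Eventually.of_forall fun s => ?_)
  beta_reduce
  rw [Real.norm_of_nonneg (D.rate_nonneg _ (hq' _)), Real.norm_of_nonneg hA0]
  exact hA _ _ (hq' _)

lemma zext_nonneg (f : BPos) (y : ℝ) : 0 ≤ zext f.toFun y := by
  unfold zext; split_ifs
  · exact f.nonneg _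
  · exact le_rfl

lemma rhs_nonneg (f : BPos) (hq' : ∀ t, q t ∈ Set.Icc (0 : ℝ) 1) (t : ℝ≥0) (x : Life) :
    0 ≤ D.rhs f q t x :=
  add_nonneg (zext_nonneg f _)
    (intervalIntegral.integral_nonneg t.coe_nonneg fun _ _ => D.rate_nonneg _ (hq' _))

lemma measurable_rhs (f : BPos) (hq : Measurable q) (hq' : ∀ t, q t ∈ Set.Icc (0 : ℝ) 1) :
    Measurable (Function.uncurry (D.rhs f q)) := by
  have h1 : Measurable fun a : ℝ≥0 × Life => zext f.toFun (a.2 - a.1) :=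
    (measurable_zext f.measurable).comp (by fun_prop)
  have h2 : Measurable fun b : (ℝ≥0 × Life) × ℝ =>
      if b.2 ∈ Set.Ioc (0 : ℝ) b.1.1 then
        D.rate (b.1.2 - b.2) (q ((b.1.1 : ℝ) - b.2).toNNReal) else 0 := by
    refine Measurable.ite ?_ (D.measurable_rate (by fun_prop)
      (hq.comp (measurable_real_toNNReal.comp (by fun_prop))) (fun s => hq' _)) measurable_const
    exact (measurableSet_lt measurable_const measurable_snd).inter
      (measurableSet_le measurable_snd (by fun_prop))
  have h3 := h2.stronglyMeasurable.integral_prod_right' (ν := (volume : Measure ℝ))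
  have h4 : Function.uncurry (D.rhs f q) = fun a : ℝ≥0 × Life => zext f.toFun (a.2 - a.1) +
      ∫ s, if s ∈ Set.Ioc (0 : ℝ) a.1 then
        D.rate (a.2 - s) (q ((a.1 : ℝ) - s).toNNReal) else 0 := by
    ext ⟨t, x⟩
    simp only [Function.uncurry, rhs]
    rw [intervalIntegral.integral_of_le t.coe_nonneg, ← integral_indicator measurableSet_Ioc]
    simp only [Set.indicator]
  rw [h4]
  exact h1.add h3.measurable

lemma rhs_anti (f : BPos) (hq : Measurable q) (hq1 : ∀ t, q t ∈ Set.Icc (0 : ℝ) 1)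
    (hr : Measurable q') (hr1 : ∀ t, q' t ∈ Set.Icc (0 : ℝ) 1) (h : ∀ t, q t ≤ q' t)
    (t : ℝ≥0) (x : Life) : D.rhs f q' t x ≤ D.rhs f q t x :=
  add_le_add_right (intervalIntegral.integral_mono_on t.coe_nonneg (D.intervalIntegrable_rate hr hr1 t x)
    (D.intervalIntegrable_rate hq hq1 t x)
    (fun _ _ => D.rate_anti _ (hq1 _) (hr1 _) (h _))) _

lemma exists_rhs_bound (f : BPos) (t : ℝ≥0) : ∃ K : ℝ, ∀ s ≤ t, ∀ x, ∀ q : ℝ≥0 → ℝ,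
    Measurable q → (∀ t, q t ∈ Set.Icc (0 : ℝ) 1) → D.rhs f q s x ≤ K := by
  obtain ⟨A, hA0, hA⟩ := D.exists_rate_bound
  obtain ⟨F, hF⟩ := f.bdd
  refine ⟨max F 0 + A * t, fun s hs x q hq hq' => add_le_add ?_ ?_⟩
  · unfold zext; split_ifs
    · exact (hF _).trans (le_max_left _ _)
    · exact le_max_right _ _
  · calc ∫ r in (0 : ℝ)..s, D.rate (x - r) (q (s - r).toNNReal)
        ≤ ∫ _ in (0 : ℝ)..s, A := intervalIntegral.integral_mono_on s.2
          (D.intervalIntegrable_rate hq hq' s x) intervalIntegrable_const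
          (fun _ _ => hA _ _ (hq' _))
      _ = A * s := by simp [mul_comm]
      _ ≤ A * t := mul_le_mul_of_nonneg_left (by exact_mod_cast hs) hA0

end

lemma IsCumulant.eq_rhs {D : BranchingParams} {f : BPos} {u : ℝ≥0 → Life → ℝ}
    (h : D.IsCumulant f u) (t : ℝ≥0) (x : Life) : u t x = D.rhs f (D.expG u) t x :=
  h.eqn t x

/-- Picard iterates of the cumulant equation. -/
def picard (f : BPos) : ℕ → ℝ≥0 → Life → ℝ
  | 0 => fun _ _ => 0
  | n + 1 => D.rhs f (D.expG (picard f n))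

lemma picard_prop (f : BPos) (n : ℕ) : Measurable (Function.uncurry (D.picard f n)) ∧
    ∀ t x, 0 ≤ D.picard f n t x := by
  induction n with
  | zero => exact ⟨measurable_const, fun _ _ => le_rfl⟩
  | succ n ih =>
    exact ⟨D.measurable_rhs f (D.measurable_expG ih.1) (D.expG_mem ih.1 ih.2),
      D.rhs_nonneg f (D.expG_mem ih.1 ih.2)⟩

lemma expG_anti {u v : ℝ≥0 → Life → ℝ} (hu : Measurable (Function.uncurry u))
    (hu0 : ∀ t x, 0 ≤ u t x) (hv : Measurable (Function.uncurry v)) (hv0 : ∀ t x, 0 ≤ v t x)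
    (h : ∀ t x, u t x ≤ v t x) (t : ℝ≥0) : D.expG v t ≤ D.expG u t :=
  integral_mono (D.integrable_exp hv hv0 t) (D.integrable_exp hu hu0 t)
    fun z => Real.exp_le_exp.2 (neg_le_neg (h t z))

lemma picard_mono (f : BPos) (n : ℕ) (t : ℝ≥0) (x : Life) :
    D.picard f n t x ≤ D.picard f (n + 1) t x := by
  induction n generalizing t x with
  | zero => exact (D.picard_prop f 1).2 t x
  | succ n ih =>
    have h1 := D.picard_prop f n
    have h2 := D.picard_prop f (n + 1)
    exact D.rhs_anti f (D.measurable_expG h2.1) (D.expG_mem h2.1 h2.2) (D.measurable_expG h1.1)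
      (D.expG_mem h1.1 h1.2) (D.expG_anti h1.1 h1.2 h2.1 h2.2 ih) t x

lemma exists_isCumulant (f : BPos) : ∃ u, D.IsCumulant f u := by
  have hmono : ∀ t x, Monotone fun n => D.picard f n t x := fun t x =>
    monotone_nat_of_le_succ fun n => D.picard_mono f n t x
  have hbdd : ∀ t x, BddAbove (Set.range fun n => D.picard f n t x) := by
    intro t x
    obtain ⟨K, hK⟩ := D.exists_rhs_bound f t
    refine ⟨max K 0, ?_⟩
    rintro _ ⟨n, rfl⟩
    cases n with
    | zero => exact le_max_right _ _
    | succ n =>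
      have h := D.picard_prop f n
      exact (hK t le_rfl x _ (D.measurable_expG h.1) (D.expG_mem h.1 h.2)).trans (le_max_left _ _)
  let u : ℝ≥0 → Life → ℝ := fun t x => ⨆ n, D.picard f n t x
  have hlim : ∀ t x, Tendsto (fun n => D.picard f n t x) atTop (𝓝 (u t x)) := fun t x =>
    tendsto_atTop_ciSup (hmono t x) (hbdd t x)
  have hum : Measurable (Function.uncurry u) :=
    measurable_of_tendsto_metrizable (fun n => (D.picard_prop f n).1)
      (tendsto_pi_nhds.2 fun a => hlim a.1 a.2)
  have hu0 : ∀ t x, 0 ≤ u t x := fun t x =>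
    ge_of_tendsto' (hlim t x) fun n => (D.picard_prop f n).2 t x
  have hG : ∀ t, Tendsto (fun n => D.expG (D.picard f n) t) atTop (𝓝 (D.expG u t)) := by
    intro t
    refine tendsto_integral_of_dominated_convergence (fun _ => (1 : ℝ))
      (fun n => (D.integrable_exp (D.picard_prop f n).1
        (D.picard_prop f n).2 t).aestronglyMeasurable) (integrable_const _)
      (fun n => Eventually.of_forall fun z => ?_) (Eventually.of_forall fun z => ?_)
    · rw [Real.norm_eq_abs, Real.abs_exp]
      exact Real.exp_le_one_iff.2 (neg_nonpos.2 ((D.picard_prop f n).2 t z))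
    · exact (Real.continuous_exp.tendsto _).comp (hlim t z).neg
  obtain ⟨A, hA0, hA⟩ := D.exists_rate_bound
  obtain ⟨C, hC0, hC⟩ := D.exists_rate_lip
  refine ⟨u, hum, hu0, fun t x => ?_⟩
  have h1 : Tendsto (fun n => D.picard f (n + 1) t x) atTop (𝓝 (D.rhs f (D.expG u) t x)) := by
    refine tendsto_const_nhds.add
      (intervalIntegral.tendsto_integral_filter_of_dominated_convergence (fun _ => A)
        (Eventually.of_forall fun n => ?_) (Eventually.of_forall fun n =>
          Eventually.of_forall fun s _ => ?_) intervalIntegrable_const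
        (Eventually.of_forall fun s _ => ?_))
    · have h := D.picard_prop f n
      exact (D.measurable_rate (by fun_prop) ((D.measurable_expG h.1).comp
        (measurable_real_toNNReal.comp (by fun_prop)))
        (fun s => D.expG_mem h.1 h.2 _)).aestronglyMeasurable
    · have h := D.expG_mem (D.picard_prop f n).1 (D.picard_prop f n).2 (t - s).toNNReal
      rw [Real.norm_of_nonneg (D.rate_nonneg _ h)]
      exact hA _ _ h
    · rw [tendsto_iff_dist_tendsto_zero]
      have h3 := ((tendsto_iff_dist_tendsto_zero.1 (hG (t - s).toNNReal)).const_mul C)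
      rw [mul_zero] at h3
      refine squeeze_zero (fun _ => dist_nonneg) (fun n => ?_) h3
      exact hC _ _ _ (D.expG_mem (D.picard_prop f n).1 (D.picard_prop f n).2 _)
        (D.expG_mem hum hu0 _)
  exact tendsto_nhds_unique ((hlim t x).comp (tendsto_add_atTop_nat 1)) h1

lemma isCumulant_unique {f : BPos} {u v : ℝ≥0 → Life → ℝ} (hu : D.IsCumulant f u)
    (hv : D.IsCumulant f v) : u = v := by
  obtain ⟨C, hC0, hC⟩ := D.exists_rate_lip
  have hqu := D.expG_mem hu.measurable hu.nonneg
  have hqv := D.expG_mem hv.measurable hv.nonneg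
  have hmu := D.measurable_expG hu.measurable
  have hmv := D.measurable_expG hv.measurable
  let d : ℝ → ℝ := fun s => |D.expG u s.toNNReal - D.expG v s.toNNReal|
  have hd0 : ∀ s, 0 ≤ d s := fun s => abs_nonneg _
  have hd1 : ∀ s, d s ≤ 1 := fun s => by
    have a := hqu s.toNNReal
    have b := hqv s.toNNReal
    exact abs_sub_le_iff.2 ⟨by linarith [a.2, b.1], by linarith [b.2, a.1]⟩
  have hdm : Measurable d :=
    ((hmu.comp measurable_real_toNNReal).sub (hmv.comp measurable_real_toNNReal)).abs
  have hdi : ∀ a b, IntervalIntegrable d volume a b := fun a b =>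
    (intervalIntegrable_const (c := (1 : ℝ))).mono_fun hdm.aestronglyMeasurable
      (Eventually.of_forall fun s => by
        beta_reduce
        rw [Real.norm_of_nonneg (hd0 s)]; simpa using hd1 s)
  have hdiff : ∀ (t : ℝ≥0) (x : Life), |u t x - v t x| ≤ C * ∫ s in (0 : ℝ)..t, d s := by
    intro t x
    have e1 := hu.eq_rhs t x
    have e2 := hv.eq_rhs t x
    have e3 : u t x - v t x = ∫ s in (0 : ℝ)..t,
        (D.rate (x - s) (D.expG u (t - s).toNNReal) -
          D.rate (x - s) (D.expG v (t - s).toNNReal)) := by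
      rw [intervalIntegral.integral_sub (D.intervalIntegrable_rate hmu hqu t x)
        (D.intervalIntegrable_rate hmv hqv t x), e1, e2]
      simp only [rhs]; ring
    have e4 : ∫ s in (0 : ℝ)..t, d s = ∫ s in (0 : ℝ)..t, d (t - s) := by
      rw [intervalIntegral.integral_comp_sub_left]; simp
    rw [e3, e4, ← intervalIntegral.integral_const_mul, ← Real.norm_eq_abs]
    refine intervalIntegral.norm_integral_le_of_norm_le t.coe_nonneg
      (Eventually.of_forall fun s _ => hC _ _ _ (hqu _) (hqv _)) ?_
    have := ((hdi (t - 0) (t - t)).comp_sub_left (t : ℝ)).const_mul C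
    simpa using this
  have hdd : ∀ t : ℝ≥0, d t ≤ C * ∫ s in (0 : ℝ)..t, d s := by
    intro t
    have hi1 := D.integrable_exp hu.measurable hu.nonneg t
    have hi2 := D.integrable_exp hv.measurable hv.nonneg t
    have e : d t = ‖∫ z, (Real.exp (-u t z) - Real.exp (-v t z)) ∂D.G‖ := by
      rw [integral_sub hi1 hi2, Real.norm_eq_abs]
      simp [d, expG]
    rw [e]
    refine (norm_integral_le_of_norm_le_const (C := C * ∫ s in (0 : ℝ)..t, d s)
      (Eventually.of_forall fun z => ?_)).trans_eq (by simp)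
    refine le_trans ?_ (hdiff t z)
    have key : ∀ a b : ℝ, 0 ≤ a → a ≤ b → |Real.exp (-a) - Real.exp (-b)| ≤ |a - b| := by
      intro a b ha hab
      rw [abs_of_nonneg (sub_nonneg.2 (Real.exp_le_exp.2 (neg_le_neg hab))),
        abs_sub_comm, abs_of_nonneg (sub_nonneg.2 hab)]
      have h1 : Real.exp (-b) = Real.exp (-a) * Real.exp (-(b - a)) := by
        rw [← Real.exp_add]; ring_nf
      have h2 := Real.add_one_le_exp (-(b - a))
      have h3 : Real.exp (-a) ≤ 1 := Real.exp_le_one_iff.2 (neg_nonpos.2 ha)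
      have h4 := Real.exp_pos (-a)
      rw [h1]
      nlinarith
    rw [Real.norm_eq_abs]
    rcases le_total (u t z) (v t z) with h | h
    · exact key _ _ (hu.nonneg t z) h
    · rw [abs_sub_comm, abs_sub_comm (u t z)]; exact key _ _ (hv.nonneg t z) h
  have hpow : ∀ (n : ℕ) (t : ℝ≥0), d t ≤ (C * t) ^ n / n.factorial := by
    intro n
    induction n with
    | zero => intro t; simpa using hd1 t
    | succ n ih =>
      intro t
      refine (hdd t).trans ?_
      have h1 : ∫ s in (0 : ℝ)..t, d s ≤ ∫ s in (0 : ℝ)..t, (C ^ n / n.factorial) * s ^ n := by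
        refine intervalIntegral.integral_mono_on t.coe_nonneg (hdi _ _)
          (Continuous.intervalIntegrable (by fun_prop) _ _) fun s hs => ?_
        have := ih ⟨s, hs.1⟩
        refine this.trans_eq ?_
        change (C * s) ^ n / _ = _
        rw [mul_pow]; ring
      refine (mul_le_mul_of_nonneg_left h1 hC0).trans_eq ?_
      rw [intervalIntegral.integral_const_mul, integral_pow, Nat.factorial_succ]
      push_cast
      field_simp
      simp
      ring
  have hzero : ∀ t : ℝ≥0, d t = 0 := fun t =>
    le_antisymm (ge_of_tendsto' (FloorSemiring.tendsto_pow_div_factorial_atTop (C * t))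
      fun n => hpow n t) (hd0 t)
  funext t x
  have h0 : ∫ s in (0 : ℝ)..t, d s = 0 := by
    rw [intervalIntegral.integral_congr (g := fun _ => (0 : ℝ))]
    · simp
    · intro s hs
      rw [Set.uIcc_of_le t.coe_nonneg] at hs
      exact hzero ⟨s, hs.1⟩
  have := hdiff t x
  rw [h0, mul_zero] at this
  exact sub_eq_zero.1 (abs_nonpos_iff.1 this)

theorem existsUnique_isCumulant (f : BPos) : ∃! u, D.IsCumulant f u :=
  let ⟨u, hu⟩ := D.exists_isCumulant f
  ⟨u, hu, fun _ hv => D.isCumulant_unique hv hu⟩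

/-- `(t, x) ↦ u_t f(x)`, the unique solution of the cumulant equation. -/
def cumulant (f : BPos) : ℝ≥0 → Life → ℝ := (D.existsUnique_isCumulant f).choose

theorem cumulant_spec (f : BPos) : D.IsCumulant f (D.cumulant f) :=
  (D.existsUnique_isCumulant f).choose_spec.1

/-- `s ↦ ∫_s^∞ α(x - s) g'(x - s, 1-) G(dx)`. -/
def birthDensity (s : ℝ) : ℝ≥0∞ :=
  ∫⁻ x in {x : Life | s < x}, ENNReal.ofReal (zext D.α (x - s) * zext D.mean (x - s)) ∂D.G

end BranchingParams

/-- The functional `ψ(f) = ∫ (1 - exp(-⟨ν, f⟩)) L(dν)`. -/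
def psi (L : Measure NonzeroIntMeasure) (f : Life → ℝ) : ℝ :=
  ∫ ν, (1 - Real.exp (-ν.1.pair f)) ∂L

/-- `P` is the transition semigroup of the branching process with immigration with parameters
`(α, g, G, ψ)`: for every `t` and `σ`, `P_t(σ, ·)` is the probability measure on `𝔑(0, ∞)` with
Laplace functional `f ↦ exp(-⟨σ, u_t f⟩ - ∫_0^t ψ(u_s f) ds)`, `f ∈ B(0, ∞)⁺`. The Laplace functionals determine
`P`, so the semigroup property is a consequence and is not assumed. -/
structure IsImmigrationSemigroup (D : BranchingParams) (L : Measure NonzeroIntMeasure)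
    (P : ℝ≥0 → Kernel IntMeasure IntMeasure) : Prop where
  isMarkovKernel : ∀ t, IsMarkovKernel (P t)
  laplace : ∀ (t : ℝ≥0) (σ : IntMeasure) (f : BPos),
    ∫ ν, Real.exp (-ν.pair f.toFun) ∂(P t σ) =
      Real.exp (-σ.pair (D.cumulant f t)
        - ∫ s in (0 : ℝ)..t, psi L (D.cumulant f s.toNNReal))

/-- The transition law `P_t(σ, ·)` as a point of the space of probability measures on `𝔑(0, ∞)`
with the topology of weak convergence. -/
def IsImmigrationSemigroup.law {D : BranchingParams} {L : Measure NonzeroIntMeasure}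
    {P : ℝ≥0 → Kernel IntMeasure IntMeasure} (hP : IsImmigrationSemigroup D L P)
    (t : ℝ≥0) (σ : IntMeasure) : ProbabilityMeasure IntMeasure :=
  ⟨P t σ, (hP.isMarkovKernel t).isProbabilityMeasure σ⟩

/-- Upper Riemann sum `∑_{n ≥ 1} a M_n(a)` of a nonnegative function on `[0, ∞)`. -/
def upperSum (h : ℝ → ℝ) (a : ℝ) : ℝ≥0∞ :=
  ∑' n : ℕ, ENNReal.ofReal a * ⨆ x ∈ Set.Icc (n * a) ((n + 1) * a), ENNReal.ofReal (h x)

/-- Lower Riemann sum `∑_{n ≥ 1} a m_n(a)` of a nonnegative function on `[0, ∞)`. -/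
def lowerSum (h : ℝ → ℝ) (a : ℝ) : ℝ≥0∞ :=
  ∑' n : ℕ, ENNReal.ofReal a * ⨅ x ∈ Set.Icc (n * a) ((n + 1) * a), ENNReal.ofReal (h x)

/-- Direct Riemann integrability over `[0, ∞)` of a function that is nonnegative there. -/
structure IsDirectlyRiemannIntegrable (h : ℝ → ℝ) : Prop where
  nonneg : ∀ x, 0 ≤ x → 0 ≤ h x
  upper_lt_top : ∀ a, 0 < a → upperSum h a < ⊤
  lim_eq : ∃ l : ℝ≥0∞, Tendsto (upperSum h) (𝓝[>] 0) (𝓝 l) ∧ Tendsto (lowerSum h) (𝓝[>] 0) (𝓝 l)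

/-- Subcriticality together with the Cramér-type condition with exponent `α₁`. -/
structure SubcriticalCramer (D : BranchingParams) (α₁ : ℝ) : Prop where
  subcritical : ∫⁻ s in Set.Ioi (0 : ℝ), D.birthDensity s < 1
  pos : 0 < α₁
  dri : IsDirectlyRiemannIntegrable
    fun t => Real.exp (α₁ * t) * (1 - D.G.real {x : Life | (x : ℝ) ≤ t})
  cramer : ∫⁻ s in Set.Ioi (0 : ℝ), ENNReal.ofReal (Real.exp (α₁ * s)) * D.birthDensity s = 1

end AgeBranching

end

open AgeBranching

/-!
For `f, h ∈ B(0,∞)⁺` the function `x ↦ |u_t f(x) - u_t h(x)|` is bounded by `|f - h|(x - t)` plus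
the rates `α g'(·, 1-)` times `⟨G, |e^{-u_{t-s} f} - e^{-u_{t-s} h}|⟩`. Averaging over `G` gives a
renewal inequality whose kernel `birthDensity` has mass less than one, so the `G`-average is
integrable in time. Consequently all the quantities of interest, `∫ |ψ(u_s f) - ψ(u_s h)| ds` and
the defects `1 - ∫ e^{-⟨ν, f⟩} P_t(σ, dν)` for large `t`, are bounded by the total time that lives
distributed according to one measure `N` of finite first moment spend where `f` and `h`
(respectively `f` and `0`) differ.

Hence the Laplace functionals converge. The same bound, applied to a small constant and to the
indicator of the complement of a compact window, makes the laws tight, because the integer-valued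
measures of bounded mass carried by a compact window form a compact set. Stone–Weierstrass
identifies the limit from its Laplace functional at continuous `f`, and bounded pointwise limits
extend the formula to Borel `f`.
-/

namespace AgeBranching

open BoundedContinuousFunction

/-! ### Bounded Borel functions as iterated bounded limits of continuous functions -/

section Baire

variable {X : Type*} [TopologicalSpace X]

/-- The smallest class of real functions that contains the bounded continuous ones and is closed
under bounded pointwise limits of sequences. -/
inductive IsBddBaire : (X → ℝ) → Prop
  | cont (f : X →ᵇ ℝ) : IsBddBaire f
  | lim (F : ℕ → X → ℝ) (f : X → ℝ) (K : ℝ) (hF : ∀ n, IsBddBaire (F n))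
      (hK : ∀ n x, |F n x| ≤ K) (hf : ∀ x, Tendsto (fun n => F n x) atTop (𝓝 (f x))) :
      IsBddBaire f

namespace IsBddBaire

lemma const (c : ℝ) : IsBddBaire fun _ : X => c :=
  .cont (BoundedContinuousFunction.const X c)

lemma exists_bound {f : X → ℝ} (hf : IsBddBaire f) : ∃ K : ℝ, ∀ x, |f x| ≤ K := by
  induction hf with
  | cont f => exact ⟨‖f‖, fun x => f.norm_coe_le_norm x⟩
  | lim F f K _ hK hf _ => exact ⟨K, fun x => le_of_tendsto' (hf x).abs fun n => hK n x⟩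

lemma add {f g : X → ℝ} (hf : IsBddBaire f) (hg : IsBddBaire g) : IsBddBaire (f + g) := by
  induction hf with
  | cont f =>
    induction hg with
    | cont g => exact .cont (f + g)
    | lim F g K _ hK hg ih =>
      refine .lim (fun n => (f : X → ℝ) + F n) _ (‖f‖ + K) ih (fun n x => ?_)
        fun x => (hg x).const_add _
      exact (abs_add_le _ _).trans (add_le_add (f.norm_coe_le_norm x) (hK n x))
  | lim F f K _ hK hf ih =>
    obtain ⟨C, hC⟩ := hg.exists_bound
    refine .lim (fun n => F n + g) _ (K + C) ih (fun n x => ?_) fun x => (hf x).add_const _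
    exact (abs_add_le _ _).trans (add_le_add (hK n x) (hC x))

lemma sum {ι : Type*} {f : ι → X → ℝ} {s : Finset ι} (hf : ∀ i ∈ s, IsBddBaire (f i)) :
    IsBddBaire (∑ i ∈ s, f i) :=
  Finset.sum_induction f IsBddBaire (fun _ _ => add) (const 0) hf

lemma const_smul {f : X → ℝ} (hf : IsBddBaire f) (c : ℝ) : IsBddBaire (c • f) := by
  induction hf with
  | cont f => exact .cont (c • f)
  | lim F f K _ hK hf ih =>
    refine .lim (fun n => c • F n) _ (|c| * K) ih (fun n x => ?_) fun x => (hf x).const_smul c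
    simp only [Pi.smul_apply, smul_eq_mul, abs_mul]
    exact mul_le_mul_of_nonneg_left (hK n x) (abs_nonneg c)

lemma indicator_iUnion {A : ℕ → Set X} (hdisj : Pairwise (Function.onFun Disjoint A))
    (hA : ∀ n, IsBddBaire ((A n).indicator fun _ => (1 : ℝ))) :
    IsBddBaire ((⋃ n, A n).indicator fun _ => (1 : ℝ)) := by
  refine .lim (fun n => (⋃ i ∈ Finset.range n, A i).indicator fun _ => 1) _ 1 (fun n => ?_)
    (fun n x => ?_) fun x => (tendsto_indicator_biUnion_finset A _ x).comp tendsto_finset_range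
      |>.mono_right (pure_le_nhds _)
  · rw [Finset.indicator_biUnion _ _ fun i _ j _ hij => hdisj hij]
    convert! sum (s := Finset.range n) fun i _ => hA i
    exact (Finset.sum_apply _ _ _).symm
  · by_cases hx : x ∈ ⋃ i ∈ Finset.range n, A i
    · rw [Set.indicator_of_mem hx, abs_one]
    · rw [Set.indicator_of_notMem hx, abs_zero]; exact zero_le_one

lemma indicator_of_isClosed [HasOuterApproxClosed X] {s : Set X} (hs : IsClosed s) :
    IsBddBaire (s.indicator fun _ => (1 : ℝ)) := by
  have hle : ∀ n x, |(hs.apprSeq n x : ℝ)| ≤ 1 := fun n x => by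
    rw [NNReal.abs_eq]
    exact_mod_cast HasOuterApproxClosed.apprSeq_apply_le_one hs n x
  refine .lim (fun n x => (hs.apprSeq n x : ℝ)) _ 1
    (fun n => .cont (.ofNormedAddCommGroup _ (by fun_prop) 1 (hle n))) hle fun x => ?_
  have hlim := tendsto_pi_nhds.1 (HasOuterApproxClosed.tendsto_apprSeq hs) x
  convert! (NNReal.continuous_coe.tendsto _).comp hlim using 2
  by_cases hx : x ∈ s <;> simp [hx]

variable [MeasurableSpace X]

lemma measurable [OpensMeasurableSpace X] {f : X → ℝ} (hf : IsBddBaire f) : Measurable f := by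
  induction hf with
  | cont f => exact f.continuous.measurable
  | lim _ _ _ _ _ hf ih => exact measurable_of_tendsto_metrizable ih (tendsto_pi_nhds.2 hf)

variable [BorelSpace X] [HasOuterApproxClosed X]

lemma indicator {s : Set X} (hs : MeasurableSet s) :
    IsBddBaire (s.indicator fun _ => (1 : ℝ)) := by
  induction s, hs using MeasurableSpace.induction_on_inter
    ((BorelSpace.measurable_eq (α := X)).trans borel_eq_generateFrom_isClosed)
    isPiSystem_isClosed with
  | empty => simpa only [Set.indicator_empty] using const 0
  | basic t ht => exact indicator_of_isClosed ht
  | compl t _ ih =>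
    convert! (const 1).add (ih.const_smul (-1)) using 1
    ext x
    by_cases hx : x ∈ t <;> simp [hx]
  | iUnion A hdisj _ ih => exact indicator_iUnion hdisj ih

lemma of_simpleFunc (g : SimpleFunc X ℝ) : IsBddBaire (g : X → ℝ) := by
  induction g using SimpleFunc.induction with
  | @const c s hs =>
    convert! (indicator hs).const_smul c using 1
    ext x
    by_cases hx : x ∈ s <;> simp [hx]
  | add _ ihf ihg => exact ihf.add ihg

theorem of_measurable {f : X → ℝ} (hf : Measurable f) {K : ℝ} (hK : ∀ x, |f x| ≤ K) :
    IsBddBaire f :=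
  .lim (fun n => hf.stronglyMeasurable.approxBounded K n) f K (fun _ => of_simpleFunc _)
    (fun n x => hf.stronglyMeasurable.norm_approxBounded_le ((abs_nonneg _).trans (hK x)) n x)
    fun x => hf.stronglyMeasurable.tendsto_approxBounded_of_norm_le (hK x)

end IsBddBaire

end Baire

namespace BPos

/-- Bounded pointwise convergence of a sequence of nonnegative bounded Borel functions. -/
structure BddTendsto (F : ℕ → BPos) (f : BPos) : Prop where
  exists_bound : ∃ K : ℝ, ∀ n x, (F n).toFun x ≤ K
  tendsto : ∀ x, Tendsto (fun n => (F n).toFun x) atTop (𝓝 (f.toFun x))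

lemma exists_abs_le (f : BPos) : ∃ K : ℝ, ∀ x, |f.toFun x| ≤ K :=
  f.bdd.imp fun _ hK x => (abs_of_nonneg (f.nonneg x)).trans_le (hK x)

theorem induction_of_continuous {p : BPos → Prop} (cont : ∀ f : BPos, Continuous f.toFun → p f)
    (lim : ∀ (F : ℕ → BPos) (f : BPos), BddTendsto F f → (∀ n, p (F n)) → p f) (f : BPos) :
    p f := by
  have hposPart : ∀ g : Life → ℝ, IsBddBaire g →
      ∀ h : BPos, (∀ x, h.toFun x = max (g x) 0) → p h := by
    intro g hg
    induction hg with
    | cont g => exact fun h hh => cont h (by rw [funext hh]; fun_prop)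
    | lim F g K hF hK hg ih =>
      intro h hh
      have hbdd : ∀ n x, max (F n x) 0 ≤ max K 0 := fun n x =>
        max_le_max_right 0 ((le_abs_self _).trans (hK n x))
      refine lim (fun n => ⟨fun x => max (F n x) 0, (hF n).measurable.max measurable_const,
        fun x => le_max_right _ _, _, hbdd n⟩) h ⟨⟨_, hbdd⟩, fun x => ?_⟩
        fun n => ih n _ fun _ => rfl
      rw [hh]
      exact (hg x).max tendsto_const_nhds
  obtain ⟨K, hK⟩ := f.exists_abs_le
  exact hposPart f.toFun (.of_measurable f.measurable hK) f fun x => (max_eq_left (f.nonneg x)).symm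

end BPos

/-! ### Integer-valued measures -/

section NatValued

lemma exists_eq_natCast_of_forall_lt_imp {r : ℝ≥0} (hr : ∀ n : ℕ, r < n + 1 → r ≤ n) :
    ∃ n : ℕ, r = n :=
  ⟨⌊r⌋₊, (hr _ (Nat.lt_floor_add_one r)).antisymm (Nat.floor_le r.2)⟩

variable {X ι : Type*} [MeasurableSpace X] [PseudoMetricSpace X] [BorelSpace X] {l : Filter ι}

lemma measure_le_of_eventually_thickening_le [l.NeBot] {μs : ι → FiniteMeasure X}
    {μ : FiniteMeasure X} (hμ : Tendsto μs l (𝓝 μ)) {δ : ℝ} (hδ : 0 < δ) {F : Set X}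
    (hF : MeasurableSet F) {c : ℝ≥0∞}
    (h : ∀ᶠ i in l, (μs i : Measure X) (Metric.thickening δ F) ≤ c) : (μ : Measure X) F ≤ c := by
  have hle : ∀ x, (thickenedIndicator hδ F x : ℝ≥0∞) ≤
      (Metric.thickening δ F).indicator 1 x := fun x => by
    by_cases hx : x ∈ Metric.thickening δ F
    · simpa [hx] using thickenedIndicator_le_one hδ F x
    · simp [hx, thickenedIndicator_zero hδ F hx]
  refine (measure_le_lintegral_thickenedIndicator _ hF hδ).trans
    (le_of_tendsto (FiniteMeasure.tendsto_iff_forall_lintegral_tendsto.1 hμ _)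
      (h.mono fun i hi => le_trans ?_ hi))
  rw [← lintegral_indicator_one Metric.isOpen_thickening.measurableSet]
  exact lintegral_mono hle

lemma exists_natCast_eq_of_isClosed_of_tendsto [l.NeBot] {μs : ι → FiniteMeasure X}
    {μ : FiniteMeasure X} (hμ : Tendsto μs l (𝓝 μ))
    (hnat : ∀ᶠ i in l, ∀ B : Set X, MeasurableSet B → ∃ n : ℕ, μs i B = n) {F : Set X}
    (hF : IsClosed F) : ∃ n : ℕ, μ F = n := by
  refine exists_eq_natCast_of_forall_lt_imp fun n hn => ?_
  have hlim := tendsto_measure_cthickening_of_isClosed (μ := (μ : Measure X))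
    ⟨1, one_pos, measure_ne_top _ _⟩ hF
  have hn' : (μ : Measure X) F < n + 1 := by
    rw [← FiniteMeasure.ennreal_coeFn_eq_coeFn_toMeasure]; exact_mod_cast hn
  obtain ⟨δ, hδ, hδ0⟩ := ((hlim.eventually_lt_const hn').filter_mono nhdsWithin_le_nhds
    |>.and self_mem_nhdsWithin).exists (f := 𝓝[>] 0)
  have hev : ∀ᶠ i in l, (μs i : Measure X) (Metric.thickening δ F) ≤ n := by
    have hlimsup := FiniteMeasure.limsup_measure_closed_le_of_tendsto hμ
      (Metric.isClosed_cthickening (δ := δ) (E := F))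
    filter_upwards [hnat, eventually_lt_of_limsup_lt (hlimsup.trans_lt hδ)] with i hi hlt
    obtain ⟨m, hm⟩ := hi _ (Metric.isClosed_cthickening (δ := δ) (E := F)).measurableSet
    refine (measure_mono (Metric.thickening_subset_cthickening δ F)).trans ?_
    rw [← FiniteMeasure.ennreal_coeFn_eq_coeFn_toMeasure, hm] at hlt ⊢
    norm_cast at hlt ⊢
    omega
  have hle := measure_le_of_eventually_thickening_le hμ hδ0 hF.measurableSet hev
  rw [← FiniteMeasure.ennreal_coeFn_eq_coeFn_toMeasure] at hle
  exact_mod_cast hle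

lemma exists_natCast_eq_of_forall_isClosed {μ : FiniteMeasure X}
    (h : ∀ F : Set X, IsClosed F → ∃ n : ℕ, μ F = n) {B : Set X} (hB : MeasurableSet B) :
    ∃ n : ℕ, μ B = n := by
  refine exists_eq_natCast_of_forall_lt_imp fun n hlt => le_of_not_gt fun hn => ?_
  obtain ⟨F, hFB, hF, hnF⟩ := hB.exists_lt_isClosed_of_ne_top (μ := (μ : Measure X))
    (measure_ne_top _ _) (r := n)
    (by rw [← FiniteMeasure.ennreal_coeFn_eq_coeFn_toMeasure]; exact_mod_cast hn)
  obtain ⟨k, hk⟩ := h F hF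
  rw [← FiniteMeasure.ennreal_coeFn_eq_coeFn_toMeasure, hk] at hnF
  have hkn : (k : ℝ≥0) < n + 1 := (hk ▸ μ.apply_mono hFB).trans_lt hlt
  norm_cast at hnF hkn
  omega

theorem isClosed_setOf_natValued :
    IsClosed {μ : FiniteMeasure X | ∀ B : Set X, MeasurableSet B → ∃ n : ℕ, μ B = n} :=
  isClosed_iff_ultrafilter.2 fun _ _ hu hmem _ hB =>
    exists_natCast_eq_of_forall_isClosed
      (fun _ hF => exists_natCast_eq_of_isClosed_of_tendsto (tendsto_id'.2 hu) hmem hF) hB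

end NatValued

lemma isSFiniteKernel_of_isFiniteMeasure {α β : Type*} [MeasurableSpace α] [MeasurableSpace β]
    (κ : Kernel α β) [∀ a, IsFiniteMeasure (κ a)] : IsSFiniteKernel κ := by
  classical
  let mass : α → ℕ := fun a => ⌊(κ a Set.univ).toReal⌋₊
  have hmass : ∀ n, MeasurableSet (mass ⁻¹' {n}) := fun n =>
    (κ.measurable_coe MeasurableSet.univ).ennreal_toReal.nat_floor (measurableSet_singleton n)
  have hfin : ∀ n, IsFiniteKernel (Kernel.piecewise (hmass n) κ 0) := fun n =>
    ⟨⟨n + 1, by finiteness, fun a => by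
      rw [Kernel.piecewise_apply]
      split_ifs with ha
      · rw [← ENNReal.ofReal_toReal (measure_ne_top (κ a) _)]
        refine ENNReal.ofReal_le_of_le_toReal ?_
        rw [← (show mass a = n from ha)]
        exact_mod_cast (Nat.lt_floor_add_one _).le
      · simp⟩⟩
  have hsum : κ = Kernel.sum fun n => Kernel.piecewise (hmass n) κ 0 := by
    ext a s hs
    rw [Kernel.sum_apply, Measure.sum_apply _ hs, tsum_eq_single (mass a)]
    · rw [Kernel.piecewise_apply, if_pos (by rfl)]
    · intro n hn
      rw [Kernel.piecewise_apply, if_neg fun h => hn h.symm]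
      simp
  rw [hsum]
  infer_instance

namespace BPos

instance : Zero BPos := ⟨⟨0, measurable_const, fun _ => le_rfl, 0, fun _ => le_rfl⟩⟩

instance : Add BPos :=
  ⟨fun f h => ⟨f.toFun + h.toFun, f.measurable.add h.measurable,
    fun x => add_nonneg (f.nonneg x) (h.nonneg x),
    let ⟨K, hK⟩ := f.bdd
    let ⟨C, hC⟩ := h.bdd
    ⟨K + C, fun x => add_le_add (hK x) (hC x)⟩⟩⟩

lemma integrable (f : BPos) (μ : Measure Life) [IsFiniteMeasure μ] : Integrable f.toFun μ :=
  let ⟨_, hK⟩ := f.exists_abs_le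
  Integrable.of_bound f.measurable.aestronglyMeasurable _ (Eventually.of_forall hK)

lemma BddTendsto.tendsto_integral {F : ℕ → BPos} {f : BPos} (h : BddTendsto F f)
    (μ : Measure Life) [IsFiniteMeasure μ] :
    Tendsto (fun n => ∫ x, (F n).toFun x ∂μ) atTop (𝓝 (∫ x, f.toFun x ∂μ)) := by
  obtain ⟨K, hK⟩ := h.exists_bound
  refine tendsto_integral_of_dominated_convergence (fun _ => K)
    (fun n => (F n).measurable.aestronglyMeasurable) (integrable_const K)
    (fun n => Eventually.of_forall fun x => ?_) (Eventually.of_forall h.tendsto)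
  exact (Real.norm_of_nonneg ((F n).nonneg x)).trans_le (hK n x)

end BPos

namespace IntMeasure

instance (ν : IntMeasure) : IsFiniteMeasure ν.toMeasure :=
  inferInstanceAs (IsFiniteMeasure (ν.1 : Measure Life))

instance : T2Space IntMeasure := inferInstanceAs (T2Space (Subtype _))

instance : Zero IntMeasure := ⟨⟨0, fun _ _ => ⟨0, by simp⟩⟩⟩

lemma exists_measure_eq (ν : IntMeasure) {s : Set Life} (hs : MeasurableSet s) :
    ∃ n : ℕ, ν.toMeasure s = n := by
  obtain ⟨n, hn⟩ := ν.2 s hs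
  exact ⟨n, by rw [toMeasure, ← FiniteMeasure.ennreal_coeFn_eq_coeFn_toMeasure, hn]; simp⟩

lemma pair_nonneg (ν : IntMeasure) (f : BPos) : 0 ≤ ν.pair f.toFun :=
  integral_nonneg f.nonneg

lemma pair_add (ν : IntMeasure) (f h : BPos) :
    ν.pair (f + h).toFun = ν.pair f.toFun + ν.pair h.toFun :=
  integral_add (f.integrable _) (h.integrable _)

lemma continuous_pair {f : BPos} (hf : Continuous f.toFun) :
    Continuous fun ν : IntMeasure => ν.pair f.toFun :=
  let ⟨K, hK⟩ := f.exists_abs_le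
  (FiniteMeasure.continuous_integral_boundedContinuousFunction
    (.ofNormedAddCommGroup f.toFun hf K hK)).comp continuous_subtype_val

lemma measurable_pair (f : BPos) : Measurable fun ν : IntMeasure => ν.pair f.toFun := by
  induction f using BPos.induction_of_continuous with
  | cont f hf => exact (continuous_pair hf).measurable
  | lim F f hF ih =>
    exact measurable_of_tendsto_metrizable ih
      (tendsto_pi_nhds.2 fun ν => hF.tendsto_integral ν.toMeasure)

lemma measurable_toMeasure : Measurable toMeasure := by
  refine Measure.measurable_of_measurable_coe _ fun s hs => ?_
  have hle : ∀ x : Life, s.indicator (fun _ => (1 : ℝ)) x ≤ 1 := fun _ =>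
    Set.indicator_le_self' (fun _ _ => zero_le_one) _
  have hmeas := (measurable_pair ⟨s.indicator fun _ => 1, measurable_const.indicator hs,
    Set.indicator_nonneg fun _ _ => zero_le_one, 1, hle⟩).ennreal_ofReal
  simpa [pair, integral_indicator hs] using hmeas

/-- The identity kernel that samples a point from an integer-valued measure. -/
noncomputable def kernel : Kernel IntMeasure Life := ⟨toMeasure, measurable_toMeasure⟩

instance : IsSFiniteKernel kernel :=
  haveI (ν : IntMeasure) : IsFiniteMeasure (kernel ν) :=
    inferInstanceAs (IsFiniteMeasure ν.toMeasure)
  isSFiniteKernel_of_isFiniteMeasure kernel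

/-- The integer-valued measures of mass at most `C` that are carried by `K`. -/
def carriedBy (C : ℝ≥0) (K : Set Life) : Set IntMeasure :=
  {ν | ν.toMeasure Set.univ ≤ C ∧ ν.toMeasure Kᶜ = 0}

lemma isCompact_carriedBy (C : ℝ≥0) {K : Set Life} (hK : IsCompact K) :
    IsCompact (carriedBy C K) := by
  refine (IsEmbedding.subtypeVal.isCompact_iff (X := IntMeasure)).2 ?_
  convert! (isCompact_setOfPred_finiteMeasure_le_of_isCompact C hK).inter_right
    (isClosed_setOf_natValued (X := Life)) using 1
  ext μ
  have hiff : μ.mass ≤ C ∧ μ Kᶜ = 0 ↔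
      (μ : Measure Life) Set.univ ≤ C ∧ (μ : Measure Life) Kᶜ = 0 := by
    rw [← FiniteMeasure.null_iff_toMeasure_null, ← FiniteMeasure.ennreal_mass, ENNReal.coe_le_coe]
  constructor
  · rintro ⟨ν, hν, rfl⟩
    exact ⟨hiff.2 hν, ν.2⟩
  · rintro ⟨hμ, hnat⟩
    exact ⟨⟨μ, hnat⟩, hiff.1 hμ, rfl⟩

/-! ### Laplace functionals -/

/-- `ν ↦ exp(-⟨ν, f⟩)`, for a continuous `f`, as a bounded continuous function. -/
noncomputable def laplaceFun (f : BPos) (hf : Continuous f.toFun) : IntMeasure →ᵇ ℝ :=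
  .ofNormedAddCommGroup (fun ν => Real.exp (-ν.pair f.toFun))
    (Real.continuous_exp.comp (continuous_pair hf).neg) 1 fun ν => by
      rw [Real.norm_eq_abs, Real.abs_exp, Real.exp_le_one_iff]
      exact neg_nonpos.2 (ν.pair_nonneg f)

/-- The multiplicative monoid of the functions `ν ↦ exp(-⟨ν, f⟩)` with `f` continuous, to which
Stone–Weierstrass is applied. -/
noncomputable def laplaceMonoid : Submonoid (IntMeasure →ᵇ ℝ) where
  carrier := {F | ∃ (f : BPos) (hf : Continuous f.toFun), laplaceFun f hf = F}
  one_mem' := by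
    refine ⟨0, continuous_const, ?_⟩
    ext ν
    change Real.exp (-∫ _, (0 : ℝ) ∂ν.toMeasure) = 1
    rw [integral_zero, neg_zero, Real.exp_zero]
  mul_mem' := by
    rintro _ _ ⟨f, hf, rfl⟩ ⟨h, hh, rfl⟩
    refine ⟨f + h, hf.add hh, ?_⟩
    ext ν
    change Real.exp (-ν.pair (f + h).toFun) =
      Real.exp (-ν.pair f.toFun) * Real.exp (-ν.pair h.toFun)
    rw [pair_add, neg_add, Real.exp_add]

lemma ext_of_forall_pair_eq {ν μ : IntMeasure}
    (h : ∀ f : BPos, Continuous f.toFun → ν.pair f.toFun = μ.pair f.toFun) : ν = μ := by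
  refine Subtype.ext (Subtype.ext ?_)
  change ν.toMeasure = μ.toMeasure
  refine ext_of_forall_lintegral_eq_of_IsFiniteMeasure fun f => ?_
  let f' : BPos := ⟨fun x => f x, by fun_prop, fun x => (f x).2, nndist f 0,
    fun x => NNReal.upper_bound f x⟩
  have hf' : Continuous f'.toFun := NNReal.continuous_coe.comp f.continuous
  have hpair : ∀ ρ : IntMeasure, ∫⁻ x, f x ∂ρ.toMeasure = ENNReal.ofReal (ρ.pair f'.toFun) := by
    intro ρ
    rw [pair, ofReal_integral_eq_lintegral_ofReal (f'.integrable _)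
      (Eventually.of_forall f'.nonneg)]
    exact lintegral_congr fun x => (ENNReal.ofReal_coe_nnreal (p := f x)).symm
  exact (hpair ν).trans ((congrArg ENNReal.ofReal (h f' hf')).trans (hpair μ).symm)

lemma separatesPoints_laplaceMonoid :
    ((Algebra.adjoin ℝ (laplaceMonoid : Set (IntMeasure →ᵇ ℝ))).map
      (toContinuousMapₐ ℝ)).SeparatesPoints := by
  intro ν μ hne
  obtain ⟨f, hf, hpair⟩ :
      ∃ f : BPos, Continuous f.toFun ∧ ν.pair f.toFun ≠ μ.pair f.toFun := by
    by_contra! hall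
    exact hne (ext_of_forall_pair_eq hall)
  refine ⟨_, ⟨toContinuousMapₐ ℝ (laplaceFun f hf),
    ⟨laplaceFun f hf, Algebra.subset_adjoin ⟨f, hf, rfl⟩, rfl⟩, rfl⟩, fun hexp => hpair ?_⟩
  exact neg_injective (Real.exp_injective hexp)

end IntMeasure

/-! ### Weak convergence from a separating family of functions -/

section SeparatesPoints

variable {E : Type*} [TopologicalSpace E] [MeasurableSpace E] [BorelSpace E]

lemma abs_integral_mulExpNegMulSq_sub_le {μ : Measure E} [IsProbabilityMeasure μ] {K : Set E}
    (hK : IsCompact K) (hKm : MeasurableSet K) {ε : ℝ} (hε : 0 < ε)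
    (hμ : μ Kᶜ < ENNReal.ofReal ε) {f g : E →ᵇ ℝ} (hfg : ∀ x ∈ K, |g x - f x| < √ε) :
    |∫ x, Real.mulExpNegMulSq ε (g x) ∂μ - ∫ x, Real.mulExpNegMulSq ε (f x) ∂μ| ≤ 3 * √ε := by
  have hg := abs_lt.1 (abs_integral_sub_setIntegral_mulExpNegMulSq_comp_lt
    (g : C(E, ℝ)) hKm hε hμ)
  have hf := abs_lt.1 (abs_integral_sub_setIntegral_mulExpNegMulSq_comp_lt
    (f : C(E, ℝ)) hKm hε hμ)
  have hmass : √ε * (μ K).toReal ≤ √ε :=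
    mul_le_of_le_one_right (Real.sqrt_nonneg _) measureReal_le_one
  have honK := abs_le.1 ((abs_setIntegral_mulExpNegMulSq_comp_sub_le_mul_measure (P := μ) hK hKm
    (f : C(E, ℝ)) (g : C(E, ℝ)) hε hfg).trans hmass)
  simp only [ContinuousMap.coe_coe] at hg hf honK
  exact abs_le.2 ⟨by linarith, by linarith⟩

lemma abs_integral_mulExpNegMulSq_sub_le_of_separatesPoints {P Q : Measure E}
    [IsProbabilityMeasure P] [IsProbabilityMeasure Q] {A : Subalgebra ℝ (E →ᵇ ℝ)}
    (hA : (A.map (toContinuousMapₐ ℝ)).SeparatesPoints)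
    (heq : ∀ g ∈ A, ∫ x, g x ∂P = ∫ x, g x ∂Q) {K : Set E} (hK : IsCompact K)
    (hKm : MeasurableSet K) {ε : ℝ} (hε : 0 < ε) (hP : P Kᶜ < ENNReal.ofReal ε)
    (hQ : Q Kᶜ < ENNReal.ofReal ε) (f : E →ᵇ ℝ) :
    |∫ x, Real.mulExpNegMulSq ε (f x) ∂P - ∫ x, Real.mulExpNegMulSq ε (f x) ∂Q| ≤ 6 * √ε := by
  obtain ⟨g', hg'A, hg'near⟩ :=
    ContinuousMap.exists_mem_subalgebra_near_continuous_of_isCompact_of_separatesPoints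
      hA f hK (Real.sqrt_pos.2 hε)
  obtain ⟨g, hgA, rfl⟩ := Subalgebra.mem_map.1 hg'A
  have hgf : ∀ x ∈ K, |g x - f x| < √ε := hg'near
  have hPgf := abs_le.1 (abs_integral_mulExpNegMulSq_sub_le hK hKm hε hP hgf)
  have hQgf := abs_le.1 (abs_integral_mulExpNegMulSq_sub_le hK hKm hε hQ hgf)
  have hPQ := integral_mulExpNegMulSq_comp_eq hε heq hgA
  exact abs_le.2 ⟨by linarith, by linarith⟩

theorem integral_eq_of_separatesPoints_of_isCompact {P Q : Measure E} [IsProbabilityMeasure P]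
    [IsProbabilityMeasure Q] {A : Subalgebra ℝ (E →ᵇ ℝ)}
    (hA : (A.map (toContinuousMapₐ ℝ)).SeparatesPoints)
    (heq : ∀ g ∈ A, ∫ x, g x ∂P = ∫ x, g x ∂Q) {K : ℕ → Set E} (hK : ∀ n, IsCompact (K n))
    (hKm : ∀ n, MeasurableSet (K n)) (hP : Tendsto (fun n => P (K n)ᶜ) atTop (𝓝 0))
    (hQ : Tendsto (fun n => Q (K n)ᶜ) atTop (𝓝 0)) (f : E →ᵇ ℝ) :
    ∫ x, f x ∂P = ∫ x, f x ∂Q := by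
  have hbound : ∀ ε : ℝ, 0 < ε →
      |∫ x, Real.mulExpNegMulSq ε (f x) ∂P - ∫ x, Real.mulExpNegMulSq ε (f x) ∂Q| ≤
        6 * √ε := by
    intro ε hε
    have hε' := ENNReal.ofReal_pos.2 hε
    obtain ⟨n, hPn, hQn⟩ := ((hP.eventually_lt_const hε').and (hQ.eventually_lt_const hε')).exists
    exact abs_integral_mulExpNegMulSq_sub_le_of_separatesPoints hA heq (hK n) (hKm n) hε hPn hQn f
  have hzero : Tendsto (fun ε : ℝ => 6 * √ε) (𝓝[>] 0) (𝓝 0) :=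
    Continuous.tendsto' (by fun_prop) 0 0 (by simp) |>.mono_left nhdsWithin_le_nhds
  have hlim := ((tendsto_integral_mulExpNegMulSq_comp (P := P) f).sub
    (tendsto_integral_mulExpNegMulSq_comp (P := Q) f)).abs
  refine sub_eq_zero.1 (abs_eq_zero.1 (tendsto_nhds_unique hlim ?_))
  exact squeeze_zero' (Eventually.of_forall fun _ => abs_nonneg _)
    (eventually_nhdsWithin_of_forall hbound) hzero

lemma integral_eq_of_mem_adjoin {P Q : Measure E} [IsFiniteMeasure P] [IsFiniteMeasure Q]
    {M : Submonoid (E →ᵇ ℝ)} (h : ∀ g ∈ M, ∫ x, g x ∂P = ∫ x, g x ∂Q) {g : E →ᵇ ℝ}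
    (hg : g ∈ Algebra.adjoin ℝ (M : Set (E →ᵇ ℝ))) : ∫ x, g x ∂P = ∫ x, g x ∂Q := by
  rw [← Subalgebra.mem_toSubmodule, Algebra.adjoin_eq_span, Submonoid.closure_eq] at hg
  induction hg using Submodule.span_induction with
  | mem g hg => exact h g hg
  | zero => simp only [coe_zero, Pi.zero_apply, integral_zero]
  | add a b _ _ iha ihb =>
    simp only [coe_add, Pi.add_apply]
    rw [integral_add (a.integrable _) (b.integrable _),
      integral_add (a.integrable _) (b.integrable _), iha, ihb]
  | smul c a _ iha =>
    simp only [coe_smul]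
    rw [integral_smul, integral_smul, iha]

/-- Tightness along a filter, witnessed by prescribed sets `K n`: the masses outside the `K n` are
eventually bounded by a common null sequence. -/
def IsTightAlong {ι : Type*} (K : ℕ → Set E) (l : Filter ι) (μ : ι → ProbabilityMeasure E) :
    Prop :=
  ∃ v : ℕ → ℝ≥0, Tendsto v atTop (𝓝 0) ∧ ∀ᶠ i in l, ∀ n, μ i (K n)ᶜ ≤ v n

variable [T2Space E] {ι : Type*} {l : Filter ι} {K : ℕ → Set E}

lemma IsTightAlong.exists_tendsto_ultrafilter {μ : ι → ProbabilityMeasure E}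
    (h : IsTightAlong K l μ) (hK : ∀ n, IsCompact (K n)) (hKmono : Monotone K)
    {U : Ultrafilter ι} (hU : ↑U ≤ l) :
    ∃ η : ProbabilityMeasure E, Tendsto μ U (𝓝 η) ∧
      Tendsto (fun n => (η : Measure E) (K n)ᶜ) atTop (𝓝 0) := by
  obtain ⟨v, hv, hμ⟩ := h
  obtain ⟨η, hη, hlim⟩ := (isCompact_setOfPred_probabilityMeasure_mass_eq_compl_isCompact_le hv hK
    (.inr hKmono)).ultrafilter_le_nhds (U.map μ) (le_principal_iff.2 (hU hμ))
  refine ⟨η, hlim, tendsto_of_tendsto_of_tendsto_of_le_of_le tendsto_const_nhds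
    (ENNReal.tendsto_coe.2 hv) (fun _ => zero_le) fun n => ?_⟩
  rw [← ProbabilityMeasure.ennreal_coeFn_eq_coeFn_toMeasure]
  exact ENNReal.coe_le_coe.2 (hη n)

theorem exists_tendsto_of_isTightAlong [l.NeBot] {M : Submonoid (E →ᵇ ℝ)}
    (hM : ((Algebra.adjoin ℝ (M : Set (E →ᵇ ℝ))).map (toContinuousMapₐ ℝ)).SeparatesPoints)
    {κ : Type*} [Nonempty κ] {μ : κ → ι → ProbabilityMeasure E} (hK : ∀ n, IsCompact (K n))
    (hKmono : Monotone K) (htight : ∀ k, IsTightAlong K l (μ k))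
    (hlim : ∀ g ∈ M, ∃ c, ∀ k, Tendsto (fun i => ∫ x, g x ∂(μ k i : Measure E)) l (𝓝 c)) :
    ∃ η : ProbabilityMeasure E, ∀ k, Tendsto (μ k) l (𝓝 η) := by
  have htendsto {k : κ} {U : Ultrafilter ι} {η : ProbabilityMeasure E}
      (h : Tendsto (μ k) U (𝓝 η)) (g : E →ᵇ ℝ) :=
    ProbabilityMeasure.tendsto_iff_forall_integral_tendsto.1 h g
  obtain ⟨k₀⟩ := ‹Nonempty κ›
  obtain ⟨η, hη, hηK⟩ := (htight k₀).exists_tendsto_ultrafilter hK hKmono (Ultrafilter.of_le l)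
  refine ⟨η, fun k => (tendsto_iff_ultrafilter _ _ _).2 fun U hU => ?_⟩
  obtain ⟨η', hη', hη'K⟩ := (htight k).exists_tendsto_ultrafilter hK hKmono hU
  refine ProbabilityMeasure.tendsto_iff_forall_integral_tendsto.2 fun F => ?_
  have heq : ∀ g ∈ M, ∫ x, g x ∂(η' : Measure E) = ∫ x, g x ∂(η : Measure E) := by
    intro g hg
    obtain ⟨c, hc⟩ := hlim g hg
    exact (tendsto_nhds_unique (htendsto hη' g) ((hc k).mono_left hU)).trans
      (tendsto_nhds_unique (htendsto hη g) ((hc k₀).mono_left (Ultrafilter.of_le l))).symm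
  rw [← integral_eq_of_separatesPoints_of_isCompact hM (fun g => integral_eq_of_mem_adjoin heq) hK
    (fun n => (hK n).measurableSet) hη'K hηK F]
  exact htendsto hη' F

end SeparatesPoints

/-! ### Renewal inequalities -/

section Renewal

variable {φ H b : ℝ → ℝ≥0∞}

lemma setLIntegral_Iio_comp_sub_le (T : ℝ) {s : ℝ} (hs : 0 ≤ s) :
    ∫⁻ t in Set.Iio T, φ (t - s) ≤ ∫⁻ t in Set.Iio T, φ t := by
  rw [← lintegral_indicator measurableSet_Iio, ← lintegral_indicator measurableSet_Iio,
    ← lintegral_sub_right_eq_self (fun t => (Set.Iio T).indicator φ t) s]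
  refine lintegral_mono fun t => Set.indicator_apply_le' (fun ht => ?_) fun _ => zero_le
  rw [Set.indicator_of_mem (Set.mem_Iio.2 ((sub_le_self t hs).trans_lt ht))]

lemma setLIntegral_Iio_convolution_le (hφ : Measurable φ) (hb : Measurable b) (T : ℝ) :
    ∫⁻ t in Set.Iio T, ∫⁻ s in Set.Ioi (0 : ℝ), b s * φ (t - s) ≤
      (∫⁻ s in Set.Ioi (0 : ℝ), b s) * ∫⁻ t in Set.Iio T, φ t := by
  rw [lintegral_lintegral_swap (by fun_prop), ← lintegral_mul_const _ hb]
  refine setLIntegral_mono (hb.mul_const _) fun s hs => ?_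
  rw [lintegral_const_mul (f := fun t => φ (t - s)) _ (hφ.comp (by fun_prop))]
  exact mul_le_mul' le_rfl (setLIntegral_Iio_comp_sub_le T (le_of_lt hs))

/-- The convolution with `b` shrinks the integral over `(-∞, T)` by the factor `∫ b < 1`, and is
absorbed by the left-hand side. -/
theorem lintegral_le_of_renewal_ineq (hφ : Measurable φ) (hb : Measurable b)
    (hb1 : ∫⁻ s in Set.Ioi (0 : ℝ), b s < 1) (hfin : ∀ T, ∫⁻ t in Set.Iio T, φ t ≠ ⊤)
    (h : ∀ t, φ t ≤ H t + ∫⁻ s in Set.Ioi (0 : ℝ), b s * φ (t - s)) :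
    ∫⁻ t, φ t ≤ (1 - ∫⁻ s in Set.Ioi (0 : ℝ), b s)⁻¹ * ∫⁻ t, H t := by
  set ρ := ∫⁻ s in Set.Ioi (0 : ℝ), b s
  have hhorizon : ∀ T : ℝ, ∫⁻ t in Set.Iio T, φ t ≤ (1 - ρ)⁻¹ * ∫⁻ t, H t := by
    intro T
    have hconv : Measurable fun t => ∫⁻ s in Set.Ioi (0 : ℝ), b s * φ (t - s) :=
      Measurable.lintegral_prod_right' (f := fun p : ℝ × ℝ => b p.2 * φ (p.1 - p.2)) (by fun_prop)
    have hle : ∫⁻ t in Set.Iio T, φ t ≤ (∫⁻ t, H t) + ρ * ∫⁻ t in Set.Iio T, φ t :=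
      calc ∫⁻ t in Set.Iio T, φ t
          ≤ ∫⁻ t in Set.Iio T, (H t + ∫⁻ s in Set.Ioi (0 : ℝ), b s * φ (t - s)) :=
            lintegral_mono h
        _ = (∫⁻ t in Set.Iio T, H t) +
              ∫⁻ t in Set.Iio T, ∫⁻ s in Set.Ioi (0 : ℝ), b s * φ (t - s) :=
            lintegral_add_right _ hconv
        _ ≤ (∫⁻ t, H t) + ρ * ∫⁻ t in Set.Iio T, φ t :=
            add_le_add (setLIntegral_le_lintegral _ _) (setLIntegral_Iio_convolution_le hφ hb T)
    have habsorb : (1 - ρ) * ∫⁻ t in Set.Iio T, φ t ≤ ∫⁻ t, H t := by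
      rwa [ENNReal.sub_mul fun _ _ => hfin T, one_mul, tsub_le_iff_right]
    exact (ENNReal.mul_le_iff_le_inv (tsub_pos_of_lt hb1).ne' (by finiteness)).1 habsorb
  have hunion : (⋃ n : ℕ, Set.Iio (n : ℝ)) = Set.univ :=
    Set.eq_univ_of_forall fun x => Set.mem_iUnion.2 (exists_nat_gt x)
  rw [← setLIntegral_univ, ← hunion, setLIntegral_iUnion_of_directed]
  · exact iSup_le fun n => hhorizon n
  · exact (monotone_nat_of_le_succ fun n => Set.Iio_subset_Iio (by simp)).directed_le

end Renewal

/-! ### Occupation integrals of a decreasing lifetime -/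

lemma ofReal_abs_integral_sub_le {X : Type*} [MeasurableSpace X] {μ : Measure X} {a b : X → ℝ}
    (ha : Integrable a μ) (hb : Integrable b μ) :
    ENNReal.ofReal |∫ x, a x ∂μ - ∫ x, b x ∂μ| ≤ ∫⁻ x, ENNReal.ofReal |a x - b x| ∂μ := by
  rw [← integral_sub ha hb]
  simpa only [Real.enorm_eq_ofReal_abs] using
    enorm_integral_le_lintegral_enorm (μ := μ) fun x => a x - b x

lemma abs_exp_neg_sub_le {a b : ℝ} (ha : 0 ≤ a) (hb : 0 ≤ b) :
    |Real.exp (-a) - Real.exp (-b)| ≤ |a - b| := by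
  wlog hab : a ≤ b generalizing a b
  · rw [abs_sub_comm, abs_sub_comm a]
    exact this hb ha (le_of_not_ge hab)
  rw [abs_of_nonneg (sub_nonneg.2 (Real.exp_le_exp.2 (neg_le_neg hab))),
    abs_sub_comm, abs_of_nonneg (sub_nonneg.2 hab)]
  calc Real.exp (-a) - Real.exp (-b)
      = Real.exp (-a) * (1 - Real.exp (-(b - a))) := by
        rw [mul_sub, mul_one, ← Real.exp_add]; ring_nf
    _ ≤ 1 * (b - a) :=
        mul_le_mul (Real.exp_le_one_iff.2 (neg_nonpos.2 ha))
          (by linarith [Real.one_sub_le_exp_neg (b - a)])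
          (sub_nonneg.2 (Real.exp_le_one_iff.2 (by linarith))) zero_le_one
    _ = b - a := one_mul _

lemma zext_of_nonpos (h : Life → ℝ) {y : ℝ} (hy : y ≤ 0) : zext h y = 0 :=
  dif_neg (not_lt.2 hy)

lemma zext_of_pos (h : Life → ℝ) {y : ℝ} (hy : 0 < y) : zext h y = h ⟨y, hy⟩ :=
  dif_pos hy

/-- `∫_0^∞ k(x - t) dt`, the integral of `k` along the remaining lifetime of an individual that
starts with lifetime `x`. -/
noncomputable def travel (k : ℝ → ℝ≥0∞) (x : ℝ) : ℝ≥0∞ := ∫⁻ t in Set.Ioi (0 : ℝ), k (x - t)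

lemma measurable_travel {k : ℝ → ℝ≥0∞} (hk : Measurable k) : Measurable (travel k) :=
  Measurable.lintegral_prod_right' (f := fun p : ℝ × ℝ => k (p.1 - p.2)) (by fun_prop)

lemma travel_eq_setLIntegral_Ioo {k : ℝ → ℝ≥0∞} (hk : ∀ y ≤ 0, k y = 0) (x : ℝ) :
    travel k x = ∫⁻ t in Set.Ioo 0 x, k (x - t) := by
  have htail : ∫⁻ t in Set.Ioi 0 \ Set.Iio x, k (x - t) = 0 :=
    setLIntegral_eq_zero (measurableSet_Ioi.diff measurableSet_Iio) fun t ht =>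
      hk _ (sub_nonpos.2 (not_lt.1 ht.2))
  rw [travel, ← lintegral_inter_add_sdiff _ _ measurableSet_Iio, htail, add_zero, Set.Ioi_inter_Iio]

lemma travel_le {k : ℝ → ℝ≥0∞} {K : ℝ≥0∞} (hk : ∀ y ≤ 0, k y = 0) (hK : ∀ y, k y ≤ K) (x : ℝ) :
    travel k x ≤ K * ENNReal.ofReal x :=
  calc travel k x = ∫⁻ t in Set.Ioo 0 x, k (x - t) := travel_eq_setLIntegral_Ioo hk x
    _ ≤ ∫⁻ _ in Set.Ioo 0 x, K := lintegral_mono fun _ => hK _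
    _ = K * ENNReal.ofReal x := by rw [setLIntegral_const, Real.volume_Ioo, sub_zero]

lemma lintegral_lintegral_travel_convolution {k φ : ℝ → ℝ≥0∞} (hk : Measurable k)
    (hφ : Measurable φ) (x : ℝ) :
    ∫⁻ t, ∫⁻ s in Set.Ioi (0 : ℝ), k (x - s) * φ (t - s) = travel k x * ∫⁻ t, φ t := by
  rw [lintegral_lintegral_swap (by fun_prop), travel,
    ← lintegral_mul_const (f := fun s => k (x - s)) _ (hk.comp (by fun_prop))]
  refine lintegral_congr fun s => ?_
  rw [lintegral_const_mul (f := fun t => φ (t - s)) _ (hφ.comp (by fun_prop)),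
    lintegral_sub_right_eq_self]

lemma travel_convolution_le {k φ : ℝ → ℝ≥0∞} {K : ℝ≥0∞} (hφ : Measurable φ)
    (hk : ∀ y ≤ 0, k y = 0) (hK : ∀ y, k y ≤ K) (x t : ℝ) :
    ∫⁻ s in Set.Ioi (0 : ℝ), k (x - s) * φ (t - s) ≤ K * ∫⁻ r in Set.Ioi (t - x), φ r := by
  rw [← lintegral_const_mul _ hφ, ← lintegral_indicator (f := fun r => K * φ r) measurableSet_Ioi,
    ← lintegral_sub_left_eq_self ((Set.Ioi (t - x)).indicator _) t]
  refine (setLIntegral_le_lintegral _ _).trans (lintegral_mono fun s => ?_)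
  rcases lt_or_ge s x with hs | hs
  · rw [Set.indicator_of_mem (Set.mem_Ioi.2 (sub_lt_sub_left hs t))]
    exact mul_le_mul' (hK _) le_rfl
  · rw [hk _ (sub_nonpos.2 hs), zero_mul]
    exact zero_le

/-- `|f - h|`, extended by zero to `ℝ`. -/
noncomputable def absDiff (f h : BPos) (y : ℝ) : ℝ≥0∞ :=
  ENNReal.ofReal |zext f.toFun y - zext h.toFun y|

lemma measurable_absDiff (f h : BPos) : Measurable (absDiff f h) :=
  ((BranchingParams.measurable_zext f.measurable).sub
    (BranchingParams.measurable_zext h.measurable)).abs.ennreal_ofReal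

lemma absDiff_of_nonpos (f h : BPos) {y : ℝ} (hy : y ≤ 0) : absDiff f h y = 0 := by
  rw [absDiff, zext_of_nonpos _ hy, zext_of_nonpos _ hy, sub_zero, abs_zero, ENNReal.ofReal_zero]

lemma absDiff_le {f h : BPos} {K : ℝ} (hf : ∀ x, f.toFun x ≤ K) (hh : ∀ x, h.toFun x ≤ K) (y : ℝ) :
    absDiff f h y ≤ ENNReal.ofReal K := by
  rcases le_or_gt y 0 with hy | hy
  · exact (absDiff_of_nonpos f h hy).trans_le zero_le
  · rw [absDiff, zext_of_pos _ hy, zext_of_pos _ hy]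
    exact ENNReal.ofReal_le_ofReal (abs_sub_le_of_nonneg_of_le (f.nonneg _) (hf _) (h.nonneg _)
      (hh _))

lemma BPos.BddTendsto.tendsto_absDiff {F : ℕ → BPos} {f : BPos} (h : BPos.BddTendsto F f) (y : ℝ) :
    Tendsto (fun n => absDiff (F n) f y) atTop (𝓝 0) := by
  rcases le_or_gt y 0 with hy | hy
  · simp only [absDiff_of_nonpos _ _ hy, tendsto_const_nhds]
  · simp only [absDiff, zext_of_pos _ hy]
    simpa using ENNReal.tendsto_ofReal ((h.tendsto ⟨y, hy⟩).sub_const (f.toFun ⟨y, hy⟩)).abs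

/-- The distance `∫ N(dx) ∫_0^∞ |f - h|(x - t) dt`: the time that lives distributed by `N` spend
where `f` and `h` differ, weighted by the difference. -/
noncomputable def travelDist (N : Measure Life) (f h : BPos) : ℝ≥0∞ :=
  ∫⁻ x : Life, travel (absDiff f h) x ∂N

section TravelDist

variable {N : Measure Life}

lemma travelDist_ne_top (hN : ∫⁻ x : Life, ENNReal.ofReal x ∂N < ⊤) (f h : BPos) :
    travelDist N f h ≠ ⊤ := by
  obtain ⟨K, hK⟩ := f.bdd
  obtain ⟨K', hK'⟩ := h.bdd
  have hle := absDiff_le (K := max K K') (fun x => (hK x).trans (le_max_left _ _))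
    fun x => (hK' x).trans (le_max_right _ _)
  refine ne_top_of_le_ne_top ?_ (lintegral_mono fun x : Life =>
    travel_le (fun y hy => absDiff_of_nonpos f h hy) hle (x : ℝ))
  rw [lintegral_const_mul _ (by fun_prop)]
  exact ENNReal.mul_ne_top ENNReal.ofReal_ne_top hN.ne

lemma BPos.BddTendsto.tendsto_travel {F : ℕ → BPos} {f : BPos} (h : BPos.BddTendsto F f) (x : ℝ) :
    Tendsto (fun n => travel (absDiff (F n) f) x) atTop (𝓝 0) := by
  obtain ⟨K, hK⟩ := h.exists_bound
  have hfK : ∀ y, f.toFun y ≤ K := fun y => le_of_tendsto' (h.tendsto y) fun n => hK n y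
  simp_rw [travel_eq_setLIntegral_Ioo fun _ hy => absDiff_of_nonpos (F _) f hy]
  rw [← lintegral_zero (μ := volume.restrict (Set.Ioo 0 x))]
  refine tendsto_lintegral_of_dominated_convergence (fun _ => ENNReal.ofReal K)
    (fun n => (measurable_absDiff _ _).comp (by fun_prop))
    (fun n => Eventually.of_forall fun t => absDiff_le (hK n) hfK _) ?_
    (Eventually.of_forall fun t => h.tendsto_absDiff _)
  rw [setLIntegral_const, Real.volume_Ioo]
  finiteness

theorem BPos.BddTendsto.tendsto_travelDist (hN : ∫⁻ x : Life, ENNReal.ofReal x ∂N < ⊤)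
    {F : ℕ → BPos} {f : BPos} (h : BPos.BddTendsto F f) :
    Tendsto (fun n => travelDist N (F n) f) atTop (𝓝 0) := by
  obtain ⟨K, hK⟩ := h.exists_bound
  have hfK : ∀ x, f.toFun x ≤ K := fun x => le_of_tendsto' (h.tendsto x) fun n => hK n x
  rw [← lintegral_zero (μ := N)]
  refine tendsto_lintegral_of_dominated_convergence
    (fun x : Life => ENNReal.ofReal K * ENNReal.ofReal x)
    (fun n => (measurable_travel (measurable_absDiff _ _)).comp measurable_subtype_coe)
    (fun n => Eventually.of_forall fun x =>
      travel_le (fun y hy => absDiff_of_nonpos _ _ hy) (absDiff_le (hK n) hfK) x) ?_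
    (Eventually.of_forall fun x => h.tendsto_travel x)
  rw [lintegral_const_mul _ (by fun_prop)]
  exact ENNReal.mul_ne_top ENNReal.ofReal_ne_top hN.ne

end TravelDist

/-! ### Stability of the cumulants -/

namespace BranchingParams

variable (D : BranchingParams)

lemma measurable_mean : Measurable D.mean := by
  refine Measurable.ennreal_toReal (Measurable.tsum fun i => Measurable.mul_const ?_ _)
  simpa [ENNReal.ofReal_toReal ((D.p _).apply_ne_top i)] using
    (IsC1BddPos_measurable (D.p_c1 i)).ennreal_ofReal

lemma mean_eq_tsum (x : Life) : D.mean x = ∑' i : ℕ, (D.p x i).toReal * i := by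
  rw [mean, ENNReal.tsum_toReal_eq
    (fun i => ENNReal.mul_ne_top ((D.p x).apply_ne_top i) (ENNReal.natCast_ne_top i))]
  simp only [ENNReal.toReal_mul, ENNReal.toReal_natCast]

lemma g_sub_le (x : Life) {a b : ℝ} (ha : a ∈ Set.Icc (0 : ℝ) 1) (hb : b ∈ Set.Icc (0 : ℝ) 1)
    (hab : a ≤ b) : D.g x b - D.g x a ≤ D.mean x * (b - a) := by
  obtain ⟨m, -, hm⟩ := D.exists_mean_bound
  unfold g
  rw [← (D.g_summable x hb).tsum_sub (D.g_summable x ha), mean_eq_tsum, ← tsum_mul_right]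
  refine Summable.tsum_le_tsum (fun i => ?_)
    ((D.g_summable x hb).sub (D.g_summable x ha)) ((hm x).1.mul_right _)
  rw [← mul_sub, mul_assoc]
  exact mul_le_mul_of_nonneg_left (pow_sub_pow_le ha hb hab i) ENNReal.toReal_nonneg

/-- The mean number `α(y) g'(y, 1-)` of children per unit of time, extended by zero to `ℝ`. -/
noncomputable def meanRate (y : ℝ) : ℝ≥0∞ := ENNReal.ofReal (zext D.α y * zext D.mean y)

lemma measurable_meanRate : Measurable D.meanRate :=
  ((measurable_zext (IsC1BddPos_measurable D.α_c1)).mul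
    (measurable_zext D.measurable_mean)).ennreal_ofReal

lemma meanRate_of_nonpos (y : ℝ) (hy : y ≤ 0) : D.meanRate y = 0 := by
  rw [meanRate, zext_of_nonpos _ hy, zero_mul, ENNReal.ofReal_zero]

lemma ofReal_abs_rate_sub_le (y : ℝ) {a b : ℝ} (ha : a ∈ Set.Icc (0 : ℝ) 1)
    (hb : b ∈ Set.Icc (0 : ℝ) 1) :
    ENNReal.ofReal |D.rate y a - D.rate y b| ≤ D.meanRate y * ENNReal.ofReal |a - b| := by
  wlog hab : a ≤ b generalizing a b
  · rw [abs_sub_comm, abs_sub_comm a]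
    exact this hb ha (le_of_not_ge hab)
  rcases le_or_gt y 0 with hy | hy
  · rw [D.rate_of_not_pos (not_lt.2 hy), D.rate_of_not_pos (not_lt.2 hy), sub_self, abs_zero,
      ENNReal.ofReal_zero]
    exact zero_le
  · have hα : 0 ≤ D.α ⟨y, hy⟩ := D.α_c1.nonneg _
    have hmean : 0 ≤ D.mean ⟨y, hy⟩ := ENNReal.toReal_nonneg
    rw [meanRate, zext_of_pos _ hy, zext_of_pos _ hy,
      ← ENNReal.ofReal_mul (mul_nonneg hα hmean),
      abs_of_nonneg (sub_nonneg.2 (D.rate_anti y ha hb hab)), abs_sub_comm,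
      abs_of_nonneg (sub_nonneg.2 hab), D.rate_of_pos hy, D.rate_of_pos hy, ← mul_sub, mul_assoc]
    refine ENNReal.ofReal_le_ofReal (mul_le_mul_of_nonneg_left ?_ hα)
    linarith [D.g_sub_le ⟨y, hy⟩ ha hb hab]

/-- The supremum of `α(y) g'(y, 1-)` over `y`. -/
noncomputable def meanRateSup : ℝ≥0∞ := ⨆ y, D.meanRate y

lemma meanRate_le_meanRateSup (y : ℝ) : D.meanRate y ≤ D.meanRateSup :=
  le_iSup D.meanRate y

lemma meanRateSup_ne_top : D.meanRateSup ≠ ⊤ := by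
  obtain ⟨A, hA⟩ := D.α_c1.bdd
  obtain ⟨m, -, hm⟩ := D.exists_mean_bound
  refine ne_top_of_le_ne_top (ENNReal.ofReal_ne_top (r := A * m)) (iSup_le fun y => ?_)
  rcases le_or_gt y 0 with hy | hy
  · exact (D.meanRate_of_nonpos y hy).trans_le zero_le
  · rw [meanRate, zext_of_pos _ hy, zext_of_pos _ hy, mean_eq_tsum]
    exact ENNReal.ofReal_le_ofReal
      (mul_le_mul (hA _) (hm _).2 (tsum_nonneg fun i => by positivity)
        ((D.α_c1.nonneg _).trans (hA ⟨y, hy⟩)))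

lemma birthDensity_eq_lintegral_meanRate (s : ℝ) :
    D.birthDensity s = ∫⁻ x : Life, D.meanRate (x - s) ∂D.G := by
  have hs : MeasurableSet {x : Life | s < x} :=
    measurableSet_lt measurable_const measurable_subtype_coe
  rw [birthDensity, ← lintegral_indicator hs]
  refine lintegral_congr fun x => ?_
  by_cases hx : s < x
  · exact Set.indicator_of_mem (s := {x : Life | s < x}) hx _
  · rw [Set.indicator_of_notMem (s := {x : Life | s < x}) hx,
      D.meanRate_of_nonpos _ (sub_nonpos.2 (not_lt.1 hx))]

lemma measurable_birthDensity : Measurable D.birthDensity := by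
  rw [funext D.birthDensity_eq_lintegral_meanRate]
  exact Measurable.lintegral_prod_right' (f := fun p : ℝ × Life => D.meanRate (p.2 - p.1))
    (D.measurable_meanRate.comp (by fun_prop))

/-- The cumulant `u_t f` as a nonnegative bounded Borel function. -/
noncomputable def cumulantAt (f : BPos) (t : ℝ≥0) : BPos where
  toFun := D.cumulant f t
  measurable := (D.cumulant_spec f).measurable.comp measurable_prodMk_left
  nonneg := (D.cumulant_spec f).nonneg t
  bdd := by
    have h := D.cumulant_spec f
    obtain ⟨K, hK⟩ := D.exists_rhs_bound f t
    refine ⟨K, fun x => ?_⟩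
    rw [h.eq_rhs]
    exact hK t le_rfl x _ (D.measurable_expG h.measurable) (D.expG_mem h.measurable h.nonneg)

section

variable (f h : BPos)

/-- `|u_t f - u_t h|`. -/
noncomputable def cumulantDist (t : ℝ≥0) (x : Life) : ℝ≥0∞ :=
  ENNReal.ofReal |D.cumulant f t x - D.cumulant h t x|

lemma measurable_cumulantDist : Measurable (Function.uncurry (D.cumulantDist f h)) :=
  ((D.cumulant_spec f).measurable.sub (D.cumulant_spec h).measurable).abs.ennreal_ofReal

/-- `|⟨G, exp(-u_t f)⟩ - ⟨G, exp(-u_t h)⟩|`, extended by zero to negative times. -/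
noncomputable def expGDist : ℝ → ℝ≥0∞ :=
  (Set.Ici (0 : ℝ)).indicator fun t => ENNReal.ofReal
    |D.expG (D.cumulant f) t.toNNReal - D.expG (D.cumulant h) t.toNNReal|

lemma measurable_expGDist : Measurable (D.expGDist f h) :=
  Measurable.indicator (((D.measurable_expG (D.cumulant_spec f).measurable).comp
    measurable_real_toNNReal).sub ((D.measurable_expG (D.cumulant_spec h).measurable).comp
    measurable_real_toNNReal)).abs.ennreal_ofReal measurableSet_Ici

lemma expGDist_of_nonneg {t : ℝ} (ht : 0 ≤ t) : D.expGDist f h t = ENNReal.ofReal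
    |D.expG (D.cumulant f) t.toNNReal - D.expG (D.cumulant h) t.toNNReal| :=
  Set.indicator_of_mem (Set.mem_Ici.2 ht) _

lemma setLIntegral_Iio_expGDist_ne_top (T : ℝ) : ∫⁻ t in Set.Iio T, D.expGDist f h t ≠ ⊤ := by
  have hle : ∀ t, D.expGDist f h t ≤ (Set.Ici 0).indicator 1 t := by
    refine fun t => Set.indicator_le_indicator ?_
    have hf := D.expG_mem (D.cumulant_spec f).measurable (D.cumulant_spec f).nonneg t.toNNReal
    have hh := D.expG_mem (D.cumulant_spec h).measurable (D.cumulant_spec h).nonneg t.toNNReal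
    exact ENNReal.ofReal_le_one.2 (abs_sub_le_of_nonneg_of_le hf.1 hf.2 hh.1 hh.2)
  refine ne_top_of_le_ne_top ?_ (lintegral_mono hle)
  rw [lintegral_indicator_one measurableSet_Ici, Measure.restrict_apply measurableSet_Ici,
    Set.Ici_inter_Iio, Real.volume_Ico]
  finiteness

lemma cumulantDist_le (t : ℝ≥0) (x : Life) :
    D.cumulantDist f h t x ≤ absDiff f h (x - t) +
      ∫⁻ s in Set.Ioi (0 : ℝ), D.meanRate (x - s) * D.expGDist f h (t - s) := by
  have hf := D.cumulant_spec f
  have hh := D.cumulant_spec h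
  have hf01 := D.expG_mem hf.measurable hf.nonneg
  have hh01 := D.expG_mem hh.measurable hh.nonneg
  have hf_int := D.intervalIntegrable_rate (D.measurable_expG hf.measurable) hf01 t x
  have hh_int := D.intervalIntegrable_rate (D.measurable_expG hh.measurable) hh01 t x
  have hdiff : D.cumulant f t x - D.cumulant h t x =
      (zext f.toFun (x - t) - zext h.toFun (x - t)) +
        ((∫ s in (0 : ℝ)..t, D.rate (x - s) (D.expG (D.cumulant f) (t - s).toNNReal)) -
          ∫ s in (0 : ℝ)..t, D.rate (x - s) (D.expG (D.cumulant h) (t - s).toNNReal)) := by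
    rw [hf.eq_rhs, hh.eq_rhs, rhs, rhs]
    exact add_sub_add_comm ..
  rw [cumulantDist, hdiff]
  refine (ENNReal.ofReal_le_ofReal (abs_add_le _ _)).trans ?_
  rw [ENNReal.ofReal_add (abs_nonneg _) (abs_nonneg _),
    intervalIntegral.integral_of_le t.coe_nonneg, intervalIntegral.integral_of_le t.coe_nonneg]
  refine add_le_add_right ((ofReal_abs_integral_sub_le hf_int.1 hh_int.1).trans ?_) _
  refine (setLIntegral_mono' measurableSet_Ioc fun s hs => ?_).trans
    (lintegral_mono_set Set.Ioc_subset_Ioi_self)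
  rw [D.expGDist_of_nonneg f h (sub_nonneg.2 hs.2)]
  exact D.ofReal_abs_rate_sub_le _ (hf01 _) (hh01 _)

lemma expGDist_le_lintegral_cumulantDist {t : ℝ} (ht : 0 ≤ t) :
    D.expGDist f h t ≤ ∫⁻ x, D.cumulantDist f h t.toNNReal x ∂D.G := by
  have hf := D.cumulant_spec f
  have hh := D.cumulant_spec h
  rw [D.expGDist_of_nonneg f h ht]
  refine (ofReal_abs_integral_sub_le (D.integrable_exp hf.measurable hf.nonneg _)
    (D.integrable_exp hh.measurable hh.nonneg _)).trans (lintegral_mono fun x => ?_)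
  exact ENNReal.ofReal_le_ofReal (abs_exp_neg_sub_le (hf.nonneg _ _) (hh.nonneg _ _))

lemma expGDist_le (t : ℝ) :
    D.expGDist f h t ≤
      (Set.Ici (0 : ℝ)).indicator (fun t => ∫⁻ x : Life, absDiff f h (x - t) ∂D.G) t +
        ∫⁻ s in Set.Ioi (0 : ℝ), D.birthDensity s * D.expGDist f h (t - s) := by
  rcases lt_or_ge t 0 with ht | ht
  · exact (Set.indicator_of_notMem (Set.notMem_Ici.2 ht) _).trans_le zero_le
  have hm : Measurable fun p : Life × ℝ => D.meanRate (p.1 - p.2) * D.expGDist f h (t - p.2) :=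
    (D.measurable_meanRate.comp (by fun_prop)).mul
      ((D.measurable_expGDist f h).comp (by fun_prop))
  rw [Set.indicator_of_mem (Set.mem_Ici.2 ht)]
  calc D.expGDist f h t
      ≤ ∫⁻ x, D.cumulantDist f h t.toNNReal x ∂D.G :=
        D.expGDist_le_lintegral_cumulantDist f h ht
    _ ≤ ∫⁻ x : Life, (absDiff f h (x - t) +
          ∫⁻ s in Set.Ioi (0 : ℝ), D.meanRate (x - s) * D.expGDist f h (t - s)) ∂D.G :=
        lintegral_mono fun x => by
          simpa only [Real.coe_toNNReal t ht] using D.cumulantDist_le f h t.toNNReal x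
    _ = (∫⁻ x : Life, absDiff f h (x - t) ∂D.G) +
          ∫⁻ x : Life, (∫⁻ s in Set.Ioi (0 : ℝ),
            D.meanRate (x - s) * D.expGDist f h (t - s)) ∂D.G :=
        lintegral_add_left (f := fun x : Life => absDiff f h (x - t))
          ((measurable_absDiff f h).comp (by fun_prop)) _
    _ = _ := by
        rw [lintegral_lintegral_swap hm.aemeasurable]
        congr 1
        refine lintegral_congr fun s => ?_
        rw [lintegral_mul_const (f := fun x : Life => D.meanRate (x - s)) _
          (D.measurable_meanRate.comp (by fun_prop)), birthDensity_eq_lintegral_meanRate]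

variable {D} in
theorem lintegral_expGDist_le (hsub : ∫⁻ s in Set.Ioi (0 : ℝ), D.birthDensity s < 1) :
    ∫⁻ t, D.expGDist f h t ≤
      (1 - ∫⁻ s in Set.Ioi (0 : ℝ), D.birthDensity s)⁻¹ * travelDist D.G f h := by
  have hm : Measurable fun p : ℝ × Life => absDiff f h (p.2 - p.1) :=
    (measurable_absDiff f h).comp (by fun_prop)
  refine (lintegral_le_of_renewal_ineq (D.measurable_expGDist f h) D.measurable_birthDensity hsub
    (D.setLIntegral_Iio_expGDist_ne_top f h) (D.expGDist_le f h)).trans_eq ?_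
  rw [lintegral_indicator measurableSet_Ici, setLIntegral_congr Ioi_ae_eq_Ici.symm,
    lintegral_lintegral_swap hm.aemeasurable]
  rfl

lemma setLIntegral_cumulantDist_le (x : Life) :
    ∫⁻ t in Set.Ioi (0 : ℝ), D.cumulantDist f h t.toNNReal x ≤
      travel (absDiff f h) x +
        D.meanRateSup * ENNReal.ofReal x * ∫⁻ t, D.expGDist f h t := by
  let conv (t : ℝ) := ∫⁻ s in Set.Ioi (0 : ℝ), D.meanRate (x - s) * D.expGDist f h (t - s)
  calc ∫⁻ t in Set.Ioi (0 : ℝ), D.cumulantDist f h t.toNNReal x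
      ≤ ∫⁻ t in Set.Ioi (0 : ℝ), (absDiff f h (x - t) + conv t) :=
        setLIntegral_mono' measurableSet_Ioi fun t ht => by
          simpa only [Real.coe_toNNReal t (le_of_lt ht)] using D.cumulantDist_le f h t.toNNReal x
    _ = travel (absDiff f h) x + ∫⁻ t in Set.Ioi (0 : ℝ), conv t :=
        lintegral_add_left (f := fun t : ℝ => absDiff f h (x - t))
          ((measurable_absDiff f h).comp (by fun_prop)) _
    _ ≤ travel (absDiff f h) x + travel D.meanRate x * ∫⁻ t, D.expGDist f h t :=
        add_le_add_right ((setLIntegral_le_lintegral _ _).trans_eq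
          (lintegral_lintegral_travel_convolution D.measurable_meanRate
            (D.measurable_expGDist f h) x)) _
    _ ≤ _ := by
        gcongr
        exact travel_le D.meanRate_of_nonpos D.meanRate_le_meanRateSup x

lemma cumulantDist_le_tail (t : ℝ≥0) (x : Life) :
    D.cumulantDist f h t x ≤ absDiff f h (x - t) +
      D.meanRateSup * ∫⁻ r in Set.Ioi ((t : ℝ) - x), D.expGDist f h r :=
  (D.cumulantDist_le f h t x).trans (add_le_add_right (travel_convolution_le
    (D.measurable_expGDist f h) D.meanRate_of_nonpos D.meanRate_le_meanRateSup x t) _)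

end

lemma rate_one (y : ℝ) : D.rate y 1 = 0 := by
  by_cases hy : y ∈ Set.Ioi (0 : ℝ)
  · rw [D.rate_of_pos hy]
    simp [g, (D.p_hasSum _).tsum_eq]
  · exact D.rate_of_not_pos hy 1

lemma zext_zero (y : ℝ) : zext (0 : BPos).toFun y = 0 := by
  rcases le_or_gt y 0 with hy | hy
  · exact zext_of_nonpos _ hy
  · exact zext_of_pos _ hy

lemma cumulant_zero : D.cumulant 0 = 0 := by
  refine D.isCumulant_unique (D.cumulant_spec 0)
    ⟨measurable_const, fun _ _ => le_rfl, fun t x => ?_⟩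
  change 0 = zext (0 : BPos).toFun (x - t) +
    ∫ s in (0 : ℝ)..t, D.rate (x - s) (∫ _, Real.exp (-0) ∂D.G)
  simp [zext_zero, rate_one]

lemma cumulantDist_zero (f : BPos) (t : ℝ≥0) (x : Life) :
    D.cumulantDist f 0 t x = ENNReal.ofReal (D.cumulant f t x) := by
  rw [cumulantDist, cumulant_zero, Pi.zero_apply, Pi.zero_apply, sub_zero,
    abs_of_nonneg ((D.cumulant_spec f).nonneg t x)]

end BranchingParams

/-! ### First moments -/

lemma ofReal_le_tsum_indicator (x : Life) :
    ENNReal.ofReal x ≤ ∑' n : ℕ, {x : Life | (n : ℝ) < x}.indicator (1 : Life → ℝ≥0∞) x := by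
  have hsum : ∑ n ∈ Finset.range ⌈(x : ℝ)⌉₊, {x : Life | (n : ℝ) < x}.indicator
      (1 : Life → ℝ≥0∞) x = (⌈(x : ℝ)⌉₊ : ℝ≥0∞) := by
    refine (Finset.sum_congr rfl (g := fun _ => (1 : ℝ≥0∞)) fun n hn => ?_).trans (by simp)
    exact Set.indicator_of_mem (s := {x : Life | (n : ℝ) < x})
      (Nat.lt_ceil.1 (Finset.mem_range.1 hn)) _
  calc ENNReal.ofReal x ≤ ⌈(x : ℝ)⌉₊ :=
        ENNReal.ofReal_le_of_le_toReal (by simpa using Nat.le_ceil (x : ℝ))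
    _ ≤ _ := hsum.symm.le.trans (ENNReal.sum_le_tsum _)

lemma lintegral_ofReal_le_tsum (μ : Measure Life) :
    ∫⁻ x : Life, ENNReal.ofReal x ∂μ ≤ ∑' n : ℕ, μ {x : Life | (n : ℝ) < x} := by
  have hmeas : ∀ n : ℕ, MeasurableSet {x : Life | (n : ℝ) < x} := fun n =>
    measurableSet_lt measurable_const measurable_subtype_coe
  refine (lintegral_mono ofReal_le_tsum_indicator).trans_eq ?_
  rw [lintegral_tsum fun n => (measurable_one.indicator (hmeas n)).aemeasurable]
  exact tsum_congr fun n => lintegral_indicator_one (hmeas n)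

theorem SubcriticalCramer.lintegral_G_lt_top {D : BranchingParams} {α₁ : ℝ}
    (h : SubcriticalCramer D α₁) : ∫⁻ x : Life, ENNReal.ofReal x ∂D.G < ⊤ := by
  refine lt_of_le_of_lt ((lintegral_ofReal_le_tsum D.G).trans (ENNReal.tsum_le_tsum fun n => ?_))
    (h.dri.upper_lt_top 1 one_pos)
  have hcompl : {x : Life | (n : ℝ) < x} = {x : Life | (x : ℝ) ≤ n}ᶜ := by
    ext x
    simp
  have htail : D.G {x : Life | (n : ℝ) < x} ≤ ENNReal.ofReal
      (Real.exp (α₁ * n) * (1 - D.G.real {x : Life | (x : ℝ) ≤ n})) := by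
    rw [← ofReal_measureReal, hcompl,
      probReal_compl_eq_one_sub (measurableSet_le measurable_subtype_coe measurable_const)]
    exact ENNReal.ofReal_le_ofReal (le_mul_of_one_le_left (sub_nonneg.2 measureReal_le_one)
      (Real.one_le_exp (mul_nonneg h.pos.le (Nat.cast_nonneg n))))
  rw [ENNReal.ofReal_one, one_mul]
  exact htail.trans (le_iSup₂_of_le (n : ℝ) (by simp) le_rfl)

lemma lintegral_ofReal_le_lintegral_exp {c : ℝ} (hc : 0 < c) (μ : Measure Life) :
    ∫⁻ x : Life, ENNReal.ofReal x ∂μ ≤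
      ENNReal.ofReal c⁻¹ * ∫⁻ x : Life, ENNReal.ofReal (Real.exp (c * x)) ∂μ := by
  rw [← lintegral_const_mul _ (by fun_prop)]
  refine lintegral_mono fun x => ?_
  rw [← ENNReal.ofReal_mul (inv_nonneg.2 hc.le)]
  refine ENNReal.ofReal_le_ofReal ?_
  rw [le_inv_mul_iff₀ hc]
  linarith [Real.add_one_le_exp (c * (x : ℝ))]

lemma lintegral_lintegral_ofReal_lt_top {L : Measure NonzeroIntMeasure} {c : ℝ} (hc : 0 < c)
    (hL : ∫⁻ ν, ∫⁻ x, ENNReal.ofReal (Real.exp (c * (x : ℝ))) ∂ν.1.toMeasure ∂L < ⊤) :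
    ∫⁻ ν, ∫⁻ x : Life, ENNReal.ofReal x ∂ν.1.toMeasure ∂L < ⊤ := by
  refine (lintegral_mono fun ν => lintegral_ofReal_le_lintegral_exp hc _).trans_lt ?_
  rw [lintegral_const_mul' _ _ ENNReal.ofReal_ne_top]
  exact ENNReal.mul_lt_top ENNReal.ofReal_lt_top hL

/-! ### The immigration functional -/

section Immigration

variable (L : Measure NonzeroIntMeasure)

/-- The intensity measure `∫ ν L(dν)` of the immigrants. -/
noncomputable def intensity : Measure Life := L.bind fun ν => ν.1.toMeasure

instance [SFinite L] : SFinite (intensity L) :=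
  inferInstanceAs (SFinite
    ((IntMeasure.kernel.comap (Subtype.val : NonzeroIntMeasure → IntMeasure) (by fun_prop)) ∘ₘ L))

lemma lintegral_intensity {k : Life → ℝ≥0∞} (hk : Measurable k) :
    ∫⁻ x, k x ∂intensity L = ∫⁻ ν, ∫⁻ x, k x ∂ν.1.toMeasure ∂L :=
  Measure.lintegral_bind (IntMeasure.measurable_toMeasure.comp measurable_subtype_coe).aemeasurable
    hk.aemeasurable

lemma psi_zero : psi L 0 = 0 := by
  simp [psi, IntMeasure.pair]

variable (D : BranchingParams)

/-- A multiple of the lifetime law plus the intensity of the immigrants. The factor is chosen so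
that the travel distance for this measure bounds both the effect of the births and that of the
immigration. -/
noncomputable def dominatingMeasure : Measure Life :=
  intensity L + (D.meanRateSup * (1 - ∫⁻ s in Set.Ioi (0 : ℝ), D.birthDensity s)⁻¹ *
    (1 + ∫⁻ x : Life, ENNReal.ofReal x ∂intensity L)) • D.G

variable {D L} in
lemma lintegral_dominatingMeasure_lt_top
    (hsub : ∫⁻ s in Set.Ioi (0 : ℝ), D.birthDensity s < 1)
    (hG : ∫⁻ x : Life, ENNReal.ofReal x ∂D.G < ⊤)
    (hL : ∫⁻ x : Life, ENNReal.ofReal x ∂intensity L < ⊤) :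
    ∫⁻ x : Life, ENNReal.ofReal x ∂dominatingMeasure L D < ⊤ := by
  rw [dominatingMeasure, lintegral_add_measure, lintegral_smul_measure, smul_eq_mul]
  refine ENNReal.add_lt_top.2 ⟨hL, ENNReal.mul_lt_top (ENNReal.mul_lt_top (ENNReal.mul_lt_top
    D.meanRateSup_ne_top.lt_top ?_) (by finiteness)) hG⟩
  exact (ENNReal.inv_ne_top.2 (tsub_pos_of_lt hsub).ne').lt_top

variable {D} in
lemma travelDist_intensity_add_le (hsub : ∫⁻ s in Set.Ioi (0 : ℝ), D.birthDensity s < 1)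
    (f h : BPos) :
    travelDist (intensity L) f h + D.meanRateSup * (∫⁻ t, D.expGDist f h t) *
        (1 + ∫⁻ x : Life, ENNReal.ofReal x ∂intensity L) ≤
      travelDist (dominatingMeasure L D) f h := by
  rw [travelDist, travelDist, dominatingMeasure, lintegral_add_measure, lintegral_smul_measure,
    smul_eq_mul, ← travelDist, ← travelDist]
  refine add_le_add_right ((mul_le_mul_left (mul_le_mul_right
    (BranchingParams.lintegral_expGDist_le f h hsub) _) _).trans_eq ?_) _
  ring

variable {D} in
theorem mul_lintegral_expGDist_le_travelDist
    (hsub : ∫⁻ s in Set.Ioi (0 : ℝ), D.birthDensity s < 1) (f h : BPos) :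
    D.meanRateSup * ∫⁻ t, D.expGDist f h t ≤ travelDist (dominatingMeasure L D) f h :=
  calc D.meanRateSup * ∫⁻ t, D.expGDist f h t
      ≤ D.meanRateSup * (∫⁻ t, D.expGDist f h t) *
          (1 + ∫⁻ x : Life, ENNReal.ofReal x ∂intensity L) := le_mul_of_one_le_right' le_self_add
    _ ≤ _ := le_add_self
    _ ≤ _ := travelDist_intensity_add_le L hsub f h

variable [IsFiniteMeasure L]

lemma integrable_one_sub_exp_neg_pair (f : BPos) :
    Integrable (fun ν : NonzeroIntMeasure => 1 - Real.exp (-ν.1.pair f.toFun)) L := by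
  refine (integrable_const 1).sub (Integrable.of_bound (C := 1) (Real.measurable_exp.comp
    ((IntMeasure.measurable_pair f).comp measurable_subtype_coe).neg).aestronglyMeasurable
    (Eventually.of_forall fun ν => ?_))
  rw [Real.norm_eq_abs, Real.abs_exp, Real.exp_le_one_iff]
  exact neg_nonpos.2 (ν.1.pair_nonneg f)

lemma ofReal_abs_psi_sub_le (f h : BPos) :
    ENNReal.ofReal |psi L f.toFun - psi L h.toFun| ≤
      ∫⁻ x, ENNReal.ofReal |f.toFun x - h.toFun x| ∂intensity L := by
  rw [lintegral_intensity L (k := fun x => ENNReal.ofReal |f.toFun x - h.toFun x|)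
    (f.measurable.sub h.measurable).abs.ennreal_ofReal]
  refine (ofReal_abs_integral_sub_le (integrable_one_sub_exp_neg_pair L f)
    (integrable_one_sub_exp_neg_pair L h)).trans (lintegral_mono fun ν => ?_)
  rw [sub_sub_sub_cancel_left, abs_sub_comm]
  exact (ENNReal.ofReal_le_ofReal
    (abs_exp_neg_sub_le (ν.1.pair_nonneg f) (ν.1.pair_nonneg h))).trans
    (ofReal_abs_integral_sub_le (f.integrable _) (h.integrable _))

lemma measurable_psi_cumulant (f : BPos) :
    Measurable fun s : ℝ => psi L (D.cumulant f s.toNNReal) := by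
  let κ : Kernel (ℝ × NonzeroIntMeasure) Life :=
    IntMeasure.kernel.comap (fun p => p.2.1) (by fun_prop)
  have hcumulant : StronglyMeasurable fun q : (ℝ × NonzeroIntMeasure) × Life =>
      D.cumulant f q.1.1.toNNReal q.2 :=
    ((D.cumulant_spec f).measurable.comp (g := Function.uncurry (D.cumulant f))
      (f := fun q : (ℝ × NonzeroIntMeasure) × Life => (q.1.1.toNNReal, q.2))
      (by fun_prop)).stronglyMeasurable
  have hpair : StronglyMeasurable fun p : ℝ × NonzeroIntMeasure =>
      p.2.1.pair (D.cumulant f p.1.toNNReal) := hcumulant.integral_kernel_prod_right' (κ := κ)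
  have hexp : StronglyMeasurable fun p : ℝ × NonzeroIntMeasure =>
      1 - Real.exp (-p.2.1.pair (D.cumulant f p.1.toNNReal)) :=
    (measurable_const.sub (Real.measurable_exp.comp hpair.measurable.neg)).stronglyMeasurable
  exact hexp.integral_prod_right'.measurable

lemma lintegral_psi_sub_le (f h : BPos) :
    ∫⁻ s in Set.Ioi (0 : ℝ), ENNReal.ofReal
        |psi L (D.cumulant f s.toNNReal) - psi L (D.cumulant h s.toNNReal)| ≤
      travelDist (intensity L) f h + D.meanRateSup * (∫⁻ t, D.expGDist f h t) *
        ∫⁻ x : Life, ENNReal.ofReal x ∂intensity L := by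
  have hmeas : Measurable fun p : ℝ × Life => D.cumulantDist f h p.1.toNNReal p.2 :=
    (D.measurable_cumulantDist f h).comp (g := Function.uncurry (D.cumulantDist f h))
      (f := fun p : ℝ × Life => (p.1.toNNReal, p.2)) (by fun_prop)
  have hpsi : ∀ s : ℝ, ENNReal.ofReal
      |psi L (D.cumulant f s.toNNReal) - psi L (D.cumulant h s.toNNReal)| ≤
        ∫⁻ x, D.cumulantDist f h s.toNNReal x ∂intensity L := fun s =>
    ofReal_abs_psi_sub_le L (D.cumulantAt f s.toNNReal) (D.cumulantAt h s.toNNReal)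
  refine (lintegral_mono hpsi).trans ?_
  rw [lintegral_lintegral_swap hmeas.aemeasurable]
  refine (lintegral_mono fun x => D.setLIntegral_cumulantDist_le f h x).trans_eq ?_
  rw [lintegral_add_left (f := fun x : Life => travel (absDiff f h) x)
    ((measurable_travel (measurable_absDiff f h)).comp measurable_subtype_coe),
    ← lintegral_const_mul _ (by fun_prop), travelDist]
  congr 1
  exact lintegral_congr fun x => mul_right_comm ..

variable {D} in
theorem lintegral_psi_sub_le_travelDist
    (hsub : ∫⁻ s in Set.Ioi (0 : ℝ), D.birthDensity s < 1) (f h : BPos) :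
    ∫⁻ s in Set.Ioi (0 : ℝ), ENNReal.ofReal
        |psi L (D.cumulant f s.toNNReal) - psi L (D.cumulant h s.toNNReal)| ≤
      travelDist (dominatingMeasure L D) f h :=
  (lintegral_psi_sub_le L D f h).trans
    ((add_le_add_right (mul_le_mul_right le_add_self _) _).trans
      (travelDist_intensity_add_le L hsub f h))

end Immigration

/-! ### The descendants of the initial population die out -/

lemma tendsto_setLIntegral_Ioi_atTop {φ : ℝ → ℝ≥0∞} (hφ : ∫⁻ t, φ t ≠ ⊤) :
    Tendsto (fun t => ∫⁻ r in Set.Ioi t, φ r) atTop (𝓝 0) := by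
  have hempty : ⋂ t : ℝ, Set.Ioi t = ∅ :=
    Set.eq_empty_of_forall_notMem fun x hx => lt_irrefl x (Set.mem_iInter.1 hx x)
  simp_rw [← withDensity_apply φ measurableSet_Ioi]
  have hfin : volume.withDensity φ (Set.Ioi 0) ≠ ⊤ := by
    rw [withDensity_apply φ measurableSet_Ioi]
    exact ne_top_of_le_ne_top hφ (setLIntegral_le_lintegral _ _)
  simpa only [hempty, measure_empty, Function.comp_def] using tendsto_measure_iInter_atTop
    (fun t => measurableSet_Ioi.nullMeasurableSet) (fun _ _ hst => Set.Ioi_subset_Ioi hst) ⟨0, hfin⟩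

lemma IntMeasure.exists_measure_Ioi_eq_zero (σ : IntMeasure) :
    ∃ T : ℝ≥0, σ.toMeasure {x : Life | (T : ℝ) < x} = 0 := by
  have hmeas : ∀ T : ℝ≥0, MeasurableSet {x : Life | (T : ℝ) < x} := fun T =>
    measurableSet_lt measurable_const measurable_subtype_coe
  have hempty : ⋂ T : ℝ≥0, {x : Life | (T : ℝ) < x} = ∅ :=
    Set.eq_empty_of_forall_notMem fun x hx =>
      lt_irrefl (x : ℝ) (Set.mem_iInter.1 hx ⟨x, le_of_lt x.2⟩)
  have hlim : Tendsto (fun T : ℝ≥0 => σ.toMeasure {x : Life | (T : ℝ) < x}) atTop (𝓝 0) := by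
    simpa only [hempty, measure_empty, Function.comp_def] using
      tendsto_measure_iInter_atTop (μ := σ.toMeasure)
      (fun T => (hmeas T).nullMeasurableSet)
      (fun _ _ hST _ hx => lt_of_le_of_lt (NNReal.coe_le_coe.2 hST) hx) ⟨0, measure_ne_top _ _⟩
  obtain ⟨T, hT⟩ := (hlim.eventually_lt_const one_pos).exists
  obtain ⟨k, hk⟩ := σ.exists_measure_eq (hmeas T)
  rw [hk, Nat.cast_lt_one] at hT
  exact ⟨T, by rw [hk, hT, Nat.cast_zero]⟩

section DieOut

variable {D : BranchingParams}

lemma ofReal_pair_cumulant_le (f : BPos) {σ : IntMeasure} {T t : ℝ≥0}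
    (hσ : σ.toMeasure {x : Life | (T : ℝ) < x} = 0) (ht : T ≤ t) :
    ENNReal.ofReal (σ.pair (D.cumulant f t)) ≤
      D.meanRateSup * (∫⁻ r in Set.Ioi ((t : ℝ) - T), D.expGDist f 0 r) *
        σ.toMeasure Set.univ := by
  have hle : ∀ᵐ x : Life ∂σ.toMeasure, (x : ℝ) ≤ T := by
    rw [ae_iff]
    simpa only [not_le] using hσ
  rw [IntMeasure.pair, ofReal_integral_eq_lintegral_ofReal (f := D.cumulant f t)
    ((D.cumulantAt f t).integrable _)
    (Eventually.of_forall ((D.cumulant_spec f).nonneg t)), ← lintegral_const]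
  refine lintegral_mono_ae (hle.mono fun x hx => ?_)
  have hxt : (x : ℝ) ≤ t := hx.trans (NNReal.coe_le_coe.2 ht)
  rw [← D.cumulantDist_zero]
  refine (D.cumulantDist_le_tail f 0 t x).trans ?_
  rw [absDiff_of_nonpos _ _ (sub_nonpos.2 hxt), zero_add]
  gcongr

theorem tendsto_pair_cumulant (hsub : ∫⁻ s in Set.Ioi (0 : ℝ), D.birthDensity s < 1)
    (hG : ∫⁻ x : Life, ENNReal.ofReal x ∂D.G < ⊤) (f : BPos) (σ : IntMeasure) :
    Tendsto (fun t => σ.pair (D.cumulant f t)) atTop (𝓝 0) := by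
  obtain ⟨T, hT⟩ := σ.exists_measure_Ioi_eq_zero
  have hfin : ∫⁻ t, D.expGDist f 0 t ≠ ⊤ :=
    ne_top_of_le_ne_top (ENNReal.mul_ne_top (ENNReal.inv_ne_top.2 (tsub_pos_of_lt hsub).ne')
      (travelDist_ne_top hG f 0)) (BranchingParams.lintegral_expGDist_le f 0 hsub)
  have htail : Tendsto (fun t : ℝ≥0 => ∫⁻ r in Set.Ioi ((t : ℝ) - T), D.expGDist f 0 r) atTop
      (𝓝 0) := (tendsto_setLIntegral_Ioi_atTop hfin).comp
    (tendsto_atTop_add_const_right _ _ (NNReal.tendsto_coe_atTop.2 tendsto_id))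
  have hbound := ENNReal.Tendsto.mul_const
    (ENNReal.Tendsto.const_mul htail (.inr D.meanRateSup_ne_top))
    (.inr (measure_ne_top σ.toMeasure Set.univ))
  rw [mul_zero, zero_mul] at hbound
  have hlim : Tendsto (fun t => ENNReal.ofReal (σ.pair (D.cumulant f t))) atTop (𝓝 0) :=
    tendsto_of_tendsto_of_tendsto_of_le_of_le' tendsto_const_nhds hbound
      (Eventually.of_forall fun _ => zero_le)
      ((eventually_ge_atTop T).mono fun t ht => ofReal_pair_cumulant_le f hT ht)
  refine ((ENNReal.tendsto_toReal ENNReal.zero_ne_top).comp hlim).congr fun t => ?_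
  exact ENNReal.toReal_ofReal (σ.pair_nonneg (D.cumulantAt f t))

end DieOut

/-! ### The limiting Laplace exponent -/

/-- The Laplace functional of a law on the integer-valued measures. -/
noncomputable def laplace (P : Measure IntMeasure) (f : BPos) : ℝ :=
  ∫ ν, Real.exp (-ν.pair f.toFun) ∂P

/-- `∫_0^∞ ψ(u_s f) ds`, the Laplace exponent of the limit law. -/
noncomputable def limitExponent (D : BranchingParams) (L : Measure NonzeroIntMeasure) (f : BPos) :
    ℝ :=
  ∫ s in Set.Ioi (0 : ℝ), psi L (D.cumulant f s.toNNReal)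

section Laplace

variable (P : Measure IntMeasure) [IsFiniteMeasure P]

lemma norm_exp_neg_pair_le_one (ν : IntMeasure) (f : BPos) :
    ‖Real.exp (-ν.pair f.toFun)‖ ≤ 1 := by
  rw [Real.norm_eq_abs, Real.abs_exp, Real.exp_le_one_iff]
  exact neg_nonpos.2 (ν.pair_nonneg f)

lemma measurable_exp_neg_pair (f : BPos) :
    Measurable fun ν : IntMeasure => Real.exp (-ν.pair f.toFun) :=
  Real.measurable_exp.comp (IntMeasure.measurable_pair f).neg

lemma BPos.BddTendsto.tendsto_laplace {F : ℕ → BPos} {f : BPos} (h : BPos.BddTendsto F f) :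
    Tendsto (fun n => laplace P (F n)) atTop (𝓝 (laplace P f)) :=
  tendsto_integral_of_dominated_convergence (fun _ => 1)
    (fun n => (measurable_exp_neg_pair (F n)).aestronglyMeasurable) (integrable_const _)
    (fun n => Eventually.of_forall fun ν => norm_exp_neg_pair_le_one ν (F n))
    (Eventually.of_forall fun ν => (Real.continuous_exp.tendsto _).comp
      (h.tendsto_integral ν.toMeasure).neg)

end Laplace

section Exponent

variable {D : BranchingParams} {L : Measure NonzeroIntMeasure} [IsFiniteMeasure L]
  (hsub : ∫⁻ s in Set.Ioi (0 : ℝ), D.birthDensity s < 1)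

include hsub

lemma lintegral_psi_cumulant_le (f : BPos) :
    ∫⁻ s in Set.Ioi (0 : ℝ), ‖psi L (D.cumulant f s.toNNReal)‖ₑ ≤
      travelDist (dominatingMeasure L D) f 0 := by
  simpa only [D.cumulant_zero, Pi.zero_apply, psi_zero, sub_zero, Real.enorm_eq_ofReal_abs] using
    lintegral_psi_sub_le_travelDist L hsub f 0

variable (hN : ∫⁻ x : Life, ENNReal.ofReal x ∂dominatingMeasure L D < ⊤)

include hN

lemma integrableOn_psi_cumulant (f : BPos) :
    IntegrableOn (fun s : ℝ => psi L (D.cumulant f s.toNNReal)) (Set.Ioi 0) :=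
  ⟨(measurable_psi_cumulant L D f).aestronglyMeasurable,
    (lintegral_psi_cumulant_le hsub f).trans_lt (travelDist_ne_top hN f 0).lt_top⟩

lemma BPos.BddTendsto.tendsto_limitExponent {F : ℕ → BPos} {f : BPos} (h : BPos.BddTendsto F f) :
    Tendsto (fun n => limitExponent D L (F n)) atTop (𝓝 (limitExponent D L f)) := by
  refine tendsto_integral_of_L1 _ (integrableOn_psi_cumulant hsub hN f).1
    (Eventually.of_forall fun n => integrableOn_psi_cumulant hsub hN (F n)) ?_
  refine tendsto_of_tendsto_of_tendsto_of_le_of_le tendsto_const_nhds (h.tendsto_travelDist hN)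
    (fun _ => zero_le) fun n => ?_
  simpa only [Real.enorm_eq_ofReal_abs] using lintegral_psi_sub_le_travelDist L hsub (F n) f

theorem laplace_eq_of_continuous {η : Measure IntMeasure} [IsFiniteMeasure η]
    (hη : ∀ f : BPos, Continuous f.toFun → laplace η f = Real.exp (-limitExponent D L f))
    (f : BPos) : laplace η f = Real.exp (-limitExponent D L f) := by
  induction f using BPos.induction_of_continuous with
  | cont f hf => exact hη f hf
  | lim F f hF ih =>
    refine tendsto_nhds_unique (hF.tendsto_laplace η) ?_
    simpa only [ih, Function.comp_def] using
      (Real.continuous_exp.tendsto _).comp (hF.tendsto_limitExponent hsub hN).neg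

end Exponent

/-! ### Tightness -/

section Markov

variable (P : Measure IntMeasure) [IsProbabilityMeasure P]

lemma integrable_exp_neg_pair (f : BPos) :
    Integrable (fun ν : IntMeasure => Real.exp (-ν.pair f.toFun)) P :=
  .of_bound (measurable_exp_neg_pair f).aestronglyMeasurable 1
    (Eventually.of_forall fun ν => norm_exp_neg_pair_le_one ν f)

lemma ofReal_one_sub_laplace (f : BPos) : ENNReal.ofReal (1 - laplace P f) =
    ∫⁻ ν : IntMeasure, ENNReal.ofReal (1 - Real.exp (-ν.pair f.toFun)) ∂P := by
  have hexp_int := integrable_exp_neg_pair P f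
  have hone : 1 - laplace P f = ∫ ν : IntMeasure, (1 - Real.exp (-ν.pair f.toFun)) ∂P := by
    rw [laplace, integral_sub (integrable_const 1) hexp_int, integral_const, probReal_univ,
      one_smul]
  rw [hone]
  exact ofReal_integral_eq_lintegral_ofReal ((integrable_const 1).sub hexp_int)
    (Eventually.of_forall fun ν =>
      sub_nonneg.2 ((le_abs_self _).trans (norm_exp_neg_pair_le_one ν f)))

lemma measure_one_le_pair_le (f : BPos) :
    P {ν | 1 ≤ ν.pair f.toFun} ≤ 2 * ENNReal.ofReal (1 - laplace P f) := by
  have hexp : Real.exp (-1) ≤ 1 / 2 := by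
    rw [Real.exp_neg, one_div]
    exact inv_anti₀ two_pos (by linarith [Real.add_one_le_exp (1 : ℝ)])
  have hsubset : {ν : IntMeasure | 1 ≤ ν.pair f.toFun} ⊆
      {ν | ENNReal.ofReal (1 / 2) ≤ ENNReal.ofReal (1 - Real.exp (-ν.pair f.toFun))} :=
    fun ν (hν : 1 ≤ ν.pair f.toFun) => ENNReal.ofReal_le_ofReal <| by
      linarith [Real.exp_le_exp.2 (neg_le_neg hν)]
  have hmeas : Measurable fun ν : IntMeasure => ENNReal.ofReal (1 - Real.exp (-ν.pair f.toFun)) :=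
    (measurable_const.sub (measurable_exp_neg_pair f)).ennreal_ofReal
  have htwo : (2 : ℝ≥0∞) = (ENNReal.ofReal (1 / 2))⁻¹ := by
    rw [← ENNReal.ofReal_inv_of_pos (by norm_num), one_div, inv_inv, ENNReal.ofReal_ofNat]
  rw [ofReal_one_sub_laplace, htwo, ← ENNReal.div_eq_inv_mul]
  exact (measure_mono hsubset).trans (meas_ge_le_lintegral_div hmeas.aemeasurable
    (ENNReal.ofReal_pos.2 (by norm_num)).ne' ENNReal.ofReal_ne_top)

end Markov

/-- The compact window `[1 / (j + 1), j + 1]` of lifetimes. -/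
def window (j : ℕ) : Set Life := {x | ((j : ℝ) + 1)⁻¹ ≤ x ∧ (x : ℝ) ≤ j + 1}

lemma measurableSet_window (j : ℕ) : MeasurableSet (window j) :=
  (measurableSet_le measurable_const measurable_subtype_coe).inter
    (measurableSet_le measurable_subtype_coe measurable_const)

lemma isCompact_window (j : ℕ) : IsCompact (window j) := by
  rw [Subtype.isCompact_iff]
  convert! isCompact_Icc (a := ((j : ℝ) + 1)⁻¹) (b := (j : ℝ) + 1) using 1
  ext y
  constructor
  · rintro ⟨x, hx, rfl⟩
    exact hx
  · exact fun hy => ⟨⟨y, lt_of_lt_of_le (by positivity) hy.1⟩, hy, rfl⟩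

lemma window_mono : Monotone window := by
  intro i j hij x hx
  have hle : (i : ℝ) + 1 ≤ j + 1 := by gcongr
  exact ⟨(inv_anti₀ (by positivity) hle).trans hx.1, hx.2.trans hle⟩

lemma eventually_mem_window (x : Life) : ∀ᶠ j in atTop, x ∈ window j := by
  have hcast := tendsto_natCast_atTop_atTop (R := ℝ)
  filter_upwards [hcast.eventually_ge_atTop (x : ℝ), hcast.eventually_ge_atTop (x : ℝ)⁻¹]
    with j hx hinv
  exact ⟨inv_le_of_inv_le₀ x.2 (by linarith), by linarith⟩

/-- The constant function `1 / (j + 1)`, which detects total mass at least `j + 1`. -/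
noncomputable def massTest (j : ℕ) : BPos :=
  ⟨fun _ => ((j : ℝ) + 1)⁻¹, measurable_const, fun _ => by positivity, _, fun _ => le_rfl⟩

/-- The indicator of the complement of `window j`, which detects atoms outside the window. -/
noncomputable def outsideTest (j : ℕ) : BPos :=
  ⟨(window j)ᶜ.indicator 1, measurable_const.indicator (measurableSet_window j).compl,
    fun _ => Set.indicator_nonneg (fun _ _ => zero_le_one) _, 1,
    fun _ => Set.indicator_le_self' (fun _ _ => zero_le_one) _⟩

lemma bddTendsto_massTest : BPos.BddTendsto massTest 0 where
  exists_bound := ⟨1, fun j _ => inv_le_one_of_one_le₀ (le_add_of_nonneg_left j.cast_nonneg)⟩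
  tendsto _ := tendsto_inv_atTop_zero.comp
    (tendsto_atTop_add_const_right _ 1 tendsto_natCast_atTop_atTop)

lemma bddTendsto_outsideTest : BPos.BddTendsto outsideTest 0 where
  exists_bound := ⟨1, fun _ _ => Set.indicator_le_self' (fun _ _ => zero_le_one) _⟩
  tendsto x := tendsto_const_nhds.congr' <| (eventually_mem_window x).mono fun _ hj =>
    (Set.indicator_of_notMem (Set.notMem_compl_iff.2 hj) _).symm

/-- The integer-valued measures of mass at most `j + 1` carried by `window j`, an exhausting
sequence of compact sets. -/
def compacts (j : ℕ) : Set IntMeasure := IntMeasure.carriedBy (j + 1) (window j)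

lemma isCompact_compacts (j : ℕ) : IsCompact (compacts j) :=
  IntMeasure.isCompact_carriedBy _ (isCompact_window j)

lemma compacts_mono : Monotone compacts := fun _ _ hij _ hν =>
  ⟨hν.1.trans (by gcongr),
    measure_mono_null (Set.compl_subset_compl.2 (window_mono hij)) hν.2⟩

lemma one_le_pair_massTest {ν : IntMeasure} {j : ℕ}
    (hν : ((j + 1 : ℝ≥0) : ℝ≥0∞) < ν.toMeasure Set.univ) : 1 ≤ ν.pair (massTest j).toFun := by
  have hlt : (j : ℝ) + 1 < ν.toMeasure.real Set.univ :=
    (ENNReal.toReal_lt_toReal ENNReal.coe_ne_top (measure_ne_top _ _)).2 hν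
  change 1 ≤ ∫ _, ((j : ℝ) + 1)⁻¹ ∂ν.toMeasure
  rw [integral_const, smul_eq_mul, ← div_eq_mul_inv, one_le_div (by positivity)]
  exact hlt.le

lemma one_le_pair_outsideTest {ν : IntMeasure} {j : ℕ} (hν : ν.toMeasure (window j)ᶜ ≠ 0) :
    1 ≤ ν.pair (outsideTest j).toFun := by
  obtain ⟨n, hn⟩ := ν.exists_measure_eq (measurableSet_window j).compl
  change 1 ≤ ∫ x, (window j)ᶜ.indicator 1 x ∂ν.toMeasure
  rw [integral_indicator_one (measurableSet_window j).compl, measureReal_def, hn,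
    ENNReal.toReal_natCast, Nat.one_le_cast]
  rw [hn, Nat.cast_ne_zero] at hν
  exact Nat.one_le_iff_ne_zero.2 hν

lemma compl_compacts_subset (j : ℕ) : (compacts j)ᶜ ⊆
    {ν | 1 ≤ ν.pair (massTest j).toFun} ∪ {ν | 1 ≤ ν.pair (outsideTest j).toFun} := by
  intro ν hν
  rcases lt_or_ge ((j + 1 : ℝ≥0) : ℝ≥0∞) (ν.toMeasure Set.univ) with hmass | hmass
  · exact .inl (one_le_pair_massTest hmass)
  · exact .inr (one_le_pair_outsideTest fun hout => hν ⟨hmass, hout⟩)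

theorem isTightAlong_compacts {N : Measure Life} (hN : ∫⁻ x : Life, ENNReal.ofReal x ∂N < ⊤)
    {c : ℝ≥0∞} (hc : c ≠ ⊤) {ι : Type*} {l : Filter ι} {μ : ι → ProbabilityMeasure IntMeasure}
    (hμ : ∀ᶠ i in l, ∀ f : BPos, ENNReal.ofReal (1 - laplace (μ i) f) ≤ c * travelDist N f 0) :
    IsTightAlong compacts l μ := by
  let bound (f : BPos) : ℝ≥0∞ := 2 * (c * travelDist N f 0)
  have hfin : ∀ f, bound f ≠ ⊤ := fun f =>
    ENNReal.mul_ne_top (by finiteness) (ENNReal.mul_ne_top hc (travelDist_ne_top hN f 0))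
  have hlim : ∀ F : ℕ → BPos, BPos.BddTendsto F 0 →
      Tendsto (fun n => bound (F n)) atTop (𝓝 0) := fun F hF => by
    simpa only [mul_zero] using ENNReal.Tendsto.const_mul
      (ENNReal.Tendsto.const_mul (hF.tendsto_travelDist hN) (.inr hc)) (.inr ENNReal.ofNat_ne_top)
  have hlimAdd := (hlim _ bddTendsto_massTest).add (hlim _ bddTendsto_outsideTest)
  rw [add_zero] at hlimAdd
  refine ⟨fun j => (bound (massTest j) + bound (outsideTest j)).toNNReal,
    (ENNReal.tendsto_toNNReal ENNReal.zero_ne_top).comp hlimAdd, hμ.mono fun i hi j => ?_⟩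
  rw [← ENNReal.coe_le_coe, ENNReal.coe_toNNReal (ENNReal.add_ne_top.2 ⟨hfin _, hfin _⟩),
    ProbabilityMeasure.ennreal_coeFn_eq_coeFn_toMeasure]
  have hmarkov : ∀ f : BPos, (μ i : Measure IntMeasure) {ν | 1 ≤ ν.pair f.toFun} ≤ bound f :=
    fun f => (measure_one_le_pair_le _ f).trans (mul_le_mul_right (hi f) 2)
  exact (measure_mono (compl_compacts_subset j)).trans
    ((measure_union_le _ _).trans (add_le_add (hmarkov _) (hmarkov _)))

/-! ### Convergence of the transition laws -/

section Convergence

variable {D : BranchingParams} {L : Measure NonzeroIntMeasure}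
  {P : ℝ≥0 → Kernel IntMeasure IntMeasure} (hP : IsImmigrationSemigroup D L P)

lemma laplace_law (f : BPos) (t : ℝ≥0) (σ : IntMeasure) :
    laplace (hP.law t σ : Measure IntMeasure) f =
      Real.exp (-σ.pair (D.cumulant f t) - ∫ s in (0 : ℝ)..t, psi L (D.cumulant f s.toNNReal)) :=
  hP.laplace t σ f

lemma tendsto_laplace_law {f : BPos}
    (hψ : IntegrableOn (fun s : ℝ => psi L (D.cumulant f s.toNNReal)) (Set.Ioi 0)) {σ : IntMeasure}
    (hσ : Tendsto (fun t => σ.pair (D.cumulant f t)) atTop (𝓝 0)) :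
    Tendsto (fun t => laplace (hP.law t σ : Measure IntMeasure) f) atTop
      (𝓝 (Real.exp (-limitExponent D L f))) := by
  have himm : Tendsto (fun t : ℝ≥0 => ∫ s in (0 : ℝ)..t, psi L (D.cumulant f s.toNNReal)) atTop
      (𝓝 (limitExponent D L f)) :=
    intervalIntegral_tendsto_integral_Ioi 0 hψ (NNReal.tendsto_coe_atTop.2 tendsto_id)
  simp only [laplace_law]
  simpa only [neg_zero, zero_sub, Function.comp_def] using
    (Real.continuous_exp.tendsto _).comp (hσ.neg.sub himm)

variable (hsub : ∫⁻ s in Set.Ioi (0 : ℝ), D.birthDensity s < 1)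

include hsub

variable (L) in
lemma ofReal_pair_cumulant_le_travelDist (f : BPos) {σ : IntMeasure} {T t : ℝ≥0}
    (hσ : σ.toMeasure {x : Life | (T : ℝ) < x} = 0) (ht : T ≤ t) :
    ENNReal.ofReal (σ.pair (D.cumulant f t)) ≤
      σ.toMeasure Set.univ * travelDist (dominatingMeasure L D) f 0 := by
  refine (ofReal_pair_cumulant_le f hσ ht).trans ?_
  rw [mul_comm]
  gcongr
  exact (mul_le_mul_right (setLIntegral_le_lintegral _ _) _).trans
    (mul_lintegral_expGDist_le_travelDist L hsub f 0)

variable [IsFiniteMeasure L]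

lemma ofReal_integral_psi_cumulant_le (f : BPos) (t : ℝ≥0) :
    ENNReal.ofReal (∫ s in (0 : ℝ)..t, psi L (D.cumulant f s.toNNReal)) ≤
      travelDist (dominatingMeasure L D) f 0 := by
  rw [intervalIntegral.integral_of_le t.coe_nonneg]
  refine (Real.ofReal_le_enorm _).trans ((enorm_integral_le_lintegral_enorm _).trans ?_)
  exact (lintegral_mono_set Set.Ioc_subset_Ioi_self).trans (lintegral_psi_cumulant_le hsub f)

lemma ofReal_one_sub_laplace_law_le (f : BPos) {σ : IntMeasure} {T t : ℝ≥0}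
    (hσ : σ.toMeasure {x : Life | (T : ℝ) < x} = 0) (ht : T ≤ t) :
    ENNReal.ofReal (1 - laplace (hP.law t σ : Measure IntMeasure) f) ≤
      (σ.toMeasure Set.univ + 1) * travelDist (dominatingMeasure L D) f 0 := by
  have hle : 1 - laplace (hP.law t σ : Measure IntMeasure) f ≤
      σ.pair (D.cumulant f t) + ∫ s in (0 : ℝ)..t, psi L (D.cumulant f s.toNNReal) := by
    rw [laplace_law]
    rw [← neg_add']
    exact sub_le_comm.1 (Real.one_sub_le_exp_neg _)
  rw [add_mul, one_mul]
  exact (ENNReal.ofReal_le_ofReal hle).trans (ENNReal.ofReal_add_le.trans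
    (add_le_add (ofReal_pair_cumulant_le_travelDist L hsub f hσ ht)
      (ofReal_integral_psi_cumulant_le hsub f t)))

end Convergence

end AgeBranching

theorem mainTheorem3_general (D : BranchingParams) (L : Measure NonzeroIntMeasure)
    [IsFiniteMeasure L] (P : ℝ≥0 → Kernel IntMeasure IntMeasure)
    (hP : IsImmigrationSemigroup D L P)
    (hsub : ∫⁻ s in Set.Ioi (0 : ℝ), D.birthDensity s < 1)
    (hG : ∫⁻ x : Life, ENNReal.ofReal x ∂D.G < ⊤)
    (hL : ∫⁻ ν, ∫⁻ x : Life, ENNReal.ofReal x ∂ν.1.toMeasure ∂L < ⊤) :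
    ∃ η : ProbabilityMeasure IntMeasure,
      (∀ σ : IntMeasure, Tendsto (fun t => hP.law t σ) atTop (𝓝 η)) ∧
      ∀ f : BPos,
        IntegrableOn (fun s : ℝ => psi L (D.cumulant f s.toNNReal)) (Set.Ioi 0) ∧
        ∫ ν, Real.exp (-ν.pair f.toFun) ∂(η : Measure IntMeasure) =
          Real.exp (-∫ s in Set.Ioi (0 : ℝ), psi L (D.cumulant f s.toNNReal)) := by
  have hN : ∫⁻ x : Life, ENNReal.ofReal x ∂dominatingMeasure L D < ⊤ :=
    lintegral_dominatingMeasure_lt_top hsub hG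
      (by rwa [lintegral_intensity L measurable_subtype_coe.ennreal_ofReal])
  have hψ := integrableOn_psi_cumulant hsub hN
  have hlap : ∀ f σ, Tendsto (fun t => laplace (hP.law t σ : Measure IntMeasure) f) atTop
      (𝓝 (Real.exp (-limitExponent D L f))) := fun f σ =>
    tendsto_laplace_law hP (hψ f) (tendsto_pair_cumulant hsub hG f σ)
  have htight : ∀ σ, IsTightAlong compacts atTop fun t => hP.law t σ := fun σ => by
    obtain ⟨T, hT⟩ := σ.exists_measure_Ioi_eq_zero
    exact isTightAlong_compacts hN (by finiteness) <| (eventually_ge_atTop T).mono fun t ht f =>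
      ofReal_one_sub_laplace_law_le hP hsub f hT ht
  obtain ⟨η, hη⟩ := exists_tendsto_of_isTightAlong IntMeasure.separatesPoints_laplaceMonoid
    isCompact_compacts compacts_mono htight (by
      rintro _ ⟨f, hf, rfl⟩
      exact ⟨_, hlap f⟩)
  refine ⟨η, hη, fun f => ⟨hψ f, laplace_eq_of_continuous hsub hN (fun f hf => ?_) f⟩⟩
  exact tendsto_nhds_unique (ProbabilityMeasure.tendsto_iff_forall_integral_tendsto.1 (hη 0)
    (IntMeasure.laplaceFun f hf)) (hlap f 0)

theorem mainTheorem3 (D : BranchingParams) (L : Measure NonzeroIntMeasure) [IsFiniteMeasure L]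
    (P : ℝ≥0 → Kernel IntMeasure IntMeasure) (hP : IsImmigrationSemigroup D L P)
    (α₁ : ℝ) (hα₁ : SubcriticalCramer D α₁)
    (hL : ∫⁻ ν, ∫⁻ x, ENNReal.ofReal (Real.exp (α₁ * (x : ℝ))) ∂ν.1.toMeasure ∂L < ⊤) :
    ∃ η : ProbabilityMeasure IntMeasure,
      (∀ σ : IntMeasure, Tendsto (fun t => hP.law t σ) atTop (𝓝 η)) ∧
      ∀ f : BPos,
        IntegrableOn (fun s : ℝ => psi L (D.cumulant f s.toNNReal)) (Set.Ioi 0) ∧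
        ∫ ν, Real.exp (-ν.pair f.toFun) ∂(η : Measure IntMeasure) =
          Real.exp (-∫ s in Set.Ioi (0 : ℝ), psi L (D.cumulant f s.toNNReal)) :=
  mainTheorem3_general D L P hP hα₁.subcritical hα₁.lintegral_G_lt_top
    (lintegral_lintegral_ofReal_lt_top hα₁.pos hL)
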